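/- Conventions. All algebras are associative unital algebras over $\mathbb C$, ideals are two-sided, and Sweedler notation is used. A finite family of ideals $(J_i)_{i\in I}$ of an algebra $A$ is a complete covering if $\bigcap_i J_i=0$ and every family $(b_i)\in\prod_i A/J_i$ whose members $b_i,b_j$ agree in $A/(J_i+J_j)$ for all $i,j$ comes from an element of $A$. A differential calculus over $A$ is an $\mathbb N$-graded algebra $\Gamma(A)$ with $\Gamma^0(A)=A$ and a graded derivation $d$ of degree $1$ with $d^2=0$, generated by $A$ and $dA$. The skew tensor product $\Gamma(A)\hat\otimes\Gamma(C)$ has product $(\gamma\hat\otimes\rho)(\omega\hat\otimes\tau)=(-1)^{mn}\gamma\omega\hat\otimes\rho\tau$ for $\omega$ of degree $n$ and $\rho$ of degree $m$, and $d(\gamma\hat\otimes\rho)=d\gamma\hat\otimes\rho+(-1)^n\gamma\hat\otimes d\rho$ for $\gamma$ of degree $n$. Bundle. Let $H$ be a Hopf algebra with bijective antipode $S$. Let $\mathcal P$ be a locally trivial quantum principal fibre bundle over $B$ with structure group $H$: $\mathcal P$ is a right $H$-comodule algebra with coaction $\Delta_{\mathcal P}$, $(J_i)_{i\in I}$ is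 a complete covering of $B$, $B_i=B/J_i$ with quotient maps $\pi_i$, and there are a surjective homomorphism $\chi_i:\mathcal P\to B_i\otimes H$ for each $i$ and an injective homomorphism $\iota:B\to\mathcal P$ such that $(\mathrm{id}\otimes\Delta)\chi_i=(\chi_i\otimes\mathrm{id})\Delta_{\mathcal P}$, $\chi_i(\iota(b))=\pi_i(b)\otimes 1$, $(\ker\chi_i)_{i}$ is a complete covering of $\mathcal P$, and $\iota(B)=\{f:\Delta_{\mathcal P}(f)=f\otimes1\}$. Differential structure. Let $\Gamma(B_i)$ be differential calculi over $B_i$ and $\Gamma(H)$ a right covariant differential calculus over $H$ with coaction $\Delta^\Gamma$. Let $\Gamma(\mathcal P)=\Omega(\mathcal P)/\bigcap_i\ker(\Omega(\mathcal P)\to\Gamma(B_i)\hat\otimes\Gamma(H))$ and $\Gamma(B)=\Omega(B)/\bigcap_i\ker(\Omega(B)\to\Gamma(B_i))$, where $\Omega$ denotes the universal calculus and the maps extend $\chi_i$ and $\pi_i$. Let $\Gamma_c(\mathcal P)\subset\bigoplus_i\Gamma(B_i)\hat\otimes\Gamma(H)$ and $\Gamma_c(B)\subset\bigoplus_i\Gamma(B_i)$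 be their covering completions with respect to the kernels of the induced maps to the summands (families of elements that agree in the quotients by the sums of two of these kernels). Write $\chi_i$ also for the $i$-th projection of $\Gamma_c(\mathcal P)$; $\Gamma_c(\mathcal P)$ and the direct sum carry the componentwise differential and the coaction $\Delta^{\Gamma}_{\mathcal P}$ given componentwise by $\mathrm{id}\otimes\Delta^\Gamma$, written $\gamma\mapsto\sum\gamma_0\otimes\gamma_1$. Regard $\Gamma_c(B)$ as a subalgebra of $\Gamma_c(\mathcal P)$ by $(\gamma_i)_i\mapsto(\gamma_i\hat\otimes1)_i$. Let $\mathrm{hor}\,\Gamma_c(\mathcal P)=\{\gamma\in\Gamma_c(\mathcal P):\chi_i(\gamma)\in\Gamma(B_i)\hat\otimes H\ \forall i\}$. Covariant derivatives. A left (right) covariant derivative is a linear map $D$ ($=D_l$ or $D_r$) of $\mathrm{hor}\,\Gamma_c(\mathcal P)$ into itself that raises the degree by $1$, satisfies $D(1)=0$, commutes with the coaction, maps $\ker\chi_i\cap\mathrm{hor}\,\Gamma_c(\mathcal P)$ into itself for every $i$, and satisfies, in the left case, $D_l(\gamma\alpha)=(d\gamma)\alpha+(-1)^n\gamma D_l(\alpha)$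 for $\gamma\in\Gamma_c^n(B)$, $\alpha\in\mathrm{hor}\,\Gamma_c(\mathcal P)$, and in the right case $D_r(\alpha\gamma)=D_r(\alpha)\gamma+(-1)^n\alpha\,d\gamma$ for $\alpha\in\mathrm{hor}\,\Gamma_c^n(\mathcal P)$, $\gamma\in\Gamma_c(B)$. Since $D$ preserves these kernels, it induces maps $D_i$ of $\Gamma(B_i)\hat\otimes H$ with $D_i\chi_i=\chi_iD$; put $A_i(h)=-(\mathrm{id}\otimes\varepsilon)D_i(1\otimes h)$. Pre-connection forms. Let $\mathrm{hor}_c$ be the projection of $\Gamma(B_i)\hat\otimes\Gamma(H)$ onto $\Gamma(B_i)\hat\otimes H$ that annihilates $\gamma\hat\otimes\theta$ for $\theta$ of positive degree. A left (right) pre-connection form is a linear map $\omega=\omega_l$ ($\omega_r$) $:H\to\Gamma^1_c(\mathcal P)$ with $\omega(1)=0$, with $\Delta^\Gamma_{\mathcal P}(\omega_l(h))=\sum\omega_l(h_2)\otimes S(h_1)h_3$ (respectively $\Delta^\Gamma_{\mathcal P}(\omega_r(h))=\sum\omega_r(h_2)\otimes h_3S^{-1}(h_1)$), and with $(1-\mathrm{hor}_c)\chi_i(\omega_l(h))=-\sum1\hat\otimes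 S(h_1)dh_2$ (respectively $(1-\mathrm{hor}_c)\chi_i(\omega_r(h))=-\sum1\hat\otimes(dh_2)S^{-1}(h_1)$) for all $i$. It is the pre-connection form of $D$ if $A_i(h)=-(\mathrm{id}\otimes\varepsilon)\,\mathrm{hor}_c\,\chi_i(\omega(h))$ for all $i$ and $h$. The curvature form of $D$ is defined by the structure equation $$\Omega_l(h)=d\omega_l(h)-\sum\omega_l(h_1)\omega_l(h_2),\qquad \Omega_r(h)=d\omega_r(h)+\sum\omega_r(h_2)\omega_r(h_1).$$ Proposition 16. Let $D_l$ (respectively $D_r$) be a left (right) covariant derivative with left (right) pre-connection form $\omega_l$ ($\omega_r$) and curvature form $\Omega_l$ ($\Omega_r$). Then for all $\gamma\in\mathrm{hor}\,\Gamma_c(\mathcal P)$ $$D_l^2(\gamma)=\sum\gamma_0\,\Omega_l(\gamma_1),\qquad D_r^2(\gamma)=\sum\Omega_r(\gamma_1)\,\gamma_0 .$$ -/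

import Mathlib

open scoped TensorProduct

noncomputable section

namespace QPFB

universe u v w x

/-! ### Differential calculi -/

/-- A differential calculus `Γ(A)` over a complex algebra `A`: an `ℕ`-graded algebra with
`Γ⁰(A) = A`, a graded derivation `d` of degree one with `d² = 0`, generated by `A` and `dA`. -/
structure DifferentialCalculus (A : Type u) [Ring A] [Algebra ℂ A] where
  carrier : Type v
  [ring : Ring carrier]
  [algebra : Algebra ℂ carrier]
  /-- the component `Γⁿ(A)` -/
  grading : ℕ → Submodule ℂ carrier
  [graded : GradedAlgebra grading]
  /-- the identification of `A` with `Γ⁰(A)` -/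
  incl : A →ₐ[ℂ] carrier
  incl_injective : Function.Injective incl
  range_incl : LinearMap.range incl.toLinearMap = grading 0
  /-- the differential -/
  d : carrier →ₗ[ℂ] carrier
  d_mem : ∀ (n : ℕ) (a : carrier), a ∈ grading n → d a ∈ grading (n + 1)
  leibniz : ∀ (n : ℕ) (a b : carrier), a ∈ grading n →
    d (a * b) = d a * b + (-1 : ℂ) ^ n • (a * d b)
  d_d : ∀ a : carrier, d (d a) = 0
  generated : Algebra.adjoin ℂ (Set.range incl ∪ Set.range fun a : A => d (incl a)) = ⊤

attribute [instance] DifferentialCalculus.ring DifferentialCalculus.algebra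
  DifferentialCalculus.graded

namespace DifferentialCalculus

variable {A : Type u} [Ring A] [Algebra ℂ A] (Γ : DifferentialCalculus.{u, v} A)

/-- The grading involution, `γ ↦ (-1)ⁿ γ` on `Γⁿ(A)`. -/
def parity : Γ.carrier →ₗ[ℂ] Γ.carrier :=
  DirectSum.toModule ℂ ℕ Γ.carrier (fun n => (-1 : ℂ) ^ n • (Γ.grading n).subtype) ∘ₗ
    (DirectSum.decomposeLinearEquiv Γ.grading).toLinearMap

/-- The projection of `Γ(A)` onto `Γ⁰(A)` along the components of positive degree. -/
def projZero : Γ.carrier →ₗ[ℂ] Γ.carrier := GradedAlgebra.proj Γ.grading 0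

theorem projZero_mem_range (a : Γ.carrier) :
    Γ.projZero a ∈ LinearMap.range Γ.incl.toLinearMap := by
  rw [Γ.range_incl]
  exact SetLike.coe_mem _

/-- The projection of `Γ(A)` onto the degree zero component, as a map to `A`. -/
def degreeZero : Γ.carrier →ₗ[ℂ] A :=
  (LinearEquiv.ofInjective Γ.incl.toLinearMap Γ.incl_injective).symm.toLinearMap ∘ₗ
    LinearMap.codRestrict _ Γ.projZero Γ.projZero_mem_range

theorem parity_of_mem {n : ℕ} {a : Γ.carrier} (ha : a ∈ Γ.grading n) :
    Γ.parity a = (-1 : ℂ) ^ n • a := by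
  have h : DirectSum.decomposeLinearEquiv Γ.grading a =
      DirectSum.lof ℂ ℕ (fun n => Γ.grading n) n ⟨a, ha⟩ := DirectSum.decompose_of_mem _ ha
  rw [parity, LinearMap.comp_apply, LinearEquiv.coe_coe, h, DirectSum.toModule_lof]
  rfl

theorem incl_mem (a : A) : Γ.incl a ∈ Γ.grading 0 := by
  rw [← Γ.range_incl]
  exact ⟨a, rfl⟩

theorem parity_incl (a : A) : Γ.parity (Γ.incl a) = Γ.incl a := by
  simp [Γ.parity_of_mem (Γ.incl_mem a)]

theorem d_one : Γ.d 1 = 0 := by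
  have h := Γ.leibniz 0 1 1 (by simpa using Γ.incl_mem 1)
  simpa using h

theorem induction_homogeneous {p : Γ.carrier → Prop} (a : Γ.carrier)
    (hom : ∀ (n : ℕ) (a : Γ.carrier), a ∈ Γ.grading n → p a)
    (add : ∀ a b, p a → p b → p (a + b)) : p a :=
  DirectSum.Decomposition.inductionOn Γ.grading (hom 0 0 (Submodule.zero_mem _))
    (fun {i} m => hom i m m.2) add a

theorem parity_mul (a b : Γ.carrier) : Γ.parity (a * b) = Γ.parity a * Γ.parity b := by
  induction a using Γ.induction_homogeneous with
  | add a a' h h' => simp [add_mul, h, h']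
  | hom n a ha =>
    induction b using Γ.induction_homogeneous with
    | add b b' h h' => simp [mul_add, h, h']
    | hom m b hb =>
      rw [Γ.parity_of_mem ha, Γ.parity_of_mem hb, Γ.parity_of_mem (SetLike.mul_mem_graded ha hb)]
      simp [pow_add, smul_smul, mul_comm]

/-- The grading involution as a homomorphism of algebras. -/
def parityHom : Γ.carrier →ₐ[ℂ] Γ.carrier :=
  AlgHom.ofLinearMap Γ.parity (by simpa using Γ.parity_incl 1) Γ.parity_mul

end DifferentialCalculus

/-! ### Hopf algebras, coactions and covariant calculi -/

section Hopf

variable (H : Type w) [Ring H] [HopfAlgebra ℂ H]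

/-- A right coaction of `H` making the algebra `A` into a right `H`-comodule algebra. -/
structure RightCoaction (A : Type u) [Ring A] [Algebra ℂ A] where
  coact : A →ₐ[ℂ] A ⊗[ℂ] H
  coassoc : ∀ a : A, TensorProduct.assoc ℂ A H H (coact.toLinearMap.rTensor H (coact a)) =
    (Coalgebra.comul (R := ℂ) (A := H)).lTensor A (coact a)
  counit : ∀ a : A, TensorProduct.rid ℂ A
    ((Coalgebra.counit (R := ℂ) (A := H)).lTensor A (coact a)) = a

variable {H}

/-- Right covariance of a calculus `Γ(H)`: a right coaction `Δ^Γ` making `Γ(H)` into a right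
`H`-comodule algebra, with
`Δ^Γ(h₀ dh₁ ⋯ dhₙ) = Δ(h₀) (d ⊗ id)Δ(h₁) ⋯ (d ⊗ id)Δ(hₙ)`. Because `Δ^Γ` is multiplicative, this
formula is expressed by its values on `h` and on `dh`. -/
structure RightCovariant (Γ : DifferentialCalculus.{w, v} H)
    extends RightCoaction H Γ.carrier where
  coact_incl : ∀ h : H, coact (Γ.incl h) =
    Γ.incl.toLinearMap.rTensor H (Coalgebra.comul (R := ℂ) h)
  coact_d : ∀ h : H, coact (Γ.d (Γ.incl h)) =
    (Γ.d ∘ₗ Γ.incl.toLinearMap).rTensor H (Coalgebra.comul (R := ℂ) h)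

/-- The inverse of a bijective antipode. -/
def antipodeInv (hS : Function.Bijective (HopfAlgebra.antipode ℂ (A := H))) : H →ₗ[ℂ] H :=
  (LinearEquiv.ofBijective (HopfAlgebra.antipode ℂ (A := H)) hS).symm.toLinearMap

/-- `h ↦ ∑ h₁ ⊗ (h₂ ⊗ h₃)`. -/
def comul₃ : H →ₗ[ℂ] H ⊗[ℂ] (H ⊗[ℂ] H) :=
  (Coalgebra.comul (R := ℂ) (A := H)).lTensor H ∘ₗ Coalgebra.comul (R := ℂ)

/-- `h ↦ ∑ h₂ ⊗ S(h₁) h₃`. -/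
def adLeft : H →ₗ[ℂ] H ⊗[ℂ] H :=
  (LinearMap.mul' ℂ H).lTensor H ∘ₗ (TensorProduct.leftComm ℂ H H H).toLinearMap ∘ₗ
    (HopfAlgebra.antipode ℂ (A := H)).rTensor (H ⊗[ℂ] H) ∘ₗ comul₃

/-- `h ↦ ∑ h₂ ⊗ h₃ S⁻¹(h₁)`. -/
def adRight (hS : Function.Bijective (HopfAlgebra.antipode ℂ (A := H))) : H →ₗ[ℂ] H ⊗[ℂ] H :=
  (LinearMap.mul' ℂ H ∘ₗ (TensorProduct.comm ℂ H H).toLinearMap).lTensor H ∘ₗ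
    (TensorProduct.leftComm ℂ H H H).toLinearMap ∘ₗ
    (antipodeInv hS).rTensor (H ⊗[ℂ] H) ∘ₗ comul₃

variable (Γ : DifferentialCalculus.{w, v} H)

/-- `h ↦ ∑ S(h₁) dh₂`. -/
def maurerCartanLeft : H →ₗ[ℂ] Γ.carrier :=
  LinearMap.mul' ℂ Γ.carrier ∘ₗ
    TensorProduct.map (Γ.incl.toLinearMap ∘ₗ HopfAlgebra.antipode ℂ (A := H))
      (Γ.d ∘ₗ Γ.incl.toLinearMap) ∘ₗ Coalgebra.comul (R := ℂ)

/-- `h ↦ ∑ (dh₂) S⁻¹(h₁)`. -/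
def maurerCartanRight (hS : Function.Bijective (HopfAlgebra.antipode ℂ (A := H))) :
    H →ₗ[ℂ] Γ.carrier :=
  LinearMap.mul' ℂ Γ.carrier ∘ₗ (TensorProduct.comm ℂ Γ.carrier Γ.carrier).toLinearMap ∘ₗ
    TensorProduct.map (Γ.incl.toLinearMap ∘ₗ antipodeInv hS)
      (Γ.d ∘ₗ Γ.incl.toLinearMap) ∘ₗ Coalgebra.comul (R := ℂ)

theorem coact_parity {Γ : DifferentialCalculus.{w, v} H} (c : RightCovariant Γ)
    (a : Γ.carrier) : c.coact (Γ.parity a) = Γ.parity.rTensor H (c.coact a) := by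
  have key : c.coact.comp Γ.parityHom =
      (Algebra.TensorProduct.map Γ.parityHom (AlgHom.id ℂ H)).comp c.coact := by
    refine AlgHom.ext_of_adjoin_eq_top Γ.generated ?_
    rintro _ (⟨h, rfl⟩ | ⟨h, rfl⟩)
    · change c.coact (Γ.parity (Γ.incl h)) = Γ.parity.rTensor H (c.coact (Γ.incl h))
      rw [Γ.parity_incl, c.coact_incl, ← LinearMap.comp_apply (Γ.parity.rTensor H),
        ← LinearMap.rTensor_comp]
      congr 2
      ext a
      simp [Γ.parity_incl]
    · have hp (a : H) : Γ.parity (Γ.d (Γ.incl a)) = - Γ.d (Γ.incl a) := by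
        simp [Γ.parity_of_mem (Γ.d_mem _ _ (Γ.incl_mem a))]
      change c.coact (Γ.parity (Γ.d (Γ.incl h))) = Γ.parity.rTensor H (c.coact (Γ.d (Γ.incl h)))
      rw [hp, map_neg, c.coact_d, ← LinearMap.comp_apply (Γ.parity.rTensor H),
        ← LinearMap.rTensor_comp, ← LinearMap.neg_apply, ← LinearMap.rTensor_neg]
      congr 2
      ext a
      simp [hp]
  exact DFunLike.congr_fun key a

end Hopf

/-! ### The skew tensor product of two calculi -/

section Skew

variable {A : Type u} [Ring A] [Algebra ℂ A] {H : Type w} [Ring H] [HopfAlgebra ℂ H]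
  (Γ : DifferentialCalculus.{u, v} A) (Θ : DifferentialCalculus.{w, x} H)

/-- The skew tensor product `Γ(A) ⊗̂ Γ(H)`, with
`(γ ⊗̂ ρ)(ω ⊗̂ τ) = (-1)^{mn} γω ⊗̂ ρτ` for `ω` of degree `n` and `ρ` of degree `m`. -/
abbrev Skew : Type _ := Γ.grading ᵍ⊗[ℂ] Θ.grading

/-- The identity map from the tensor product of vector spaces to the skew tensor product. -/
abbrev toSkew : Γ.carrier ⊗[ℂ] Θ.carrier ≃ₗ[ℂ] Skew Γ Θ :=
  GradedTensorProduct.of ℂ Γ.grading Θ.grading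

/-- The differential `d(γ ⊗̂ ρ) = dγ ⊗̂ ρ + (-1)ⁿ γ ⊗̂ dρ`, for `γ` of degree `n`. -/
def skewD : Skew Γ Θ →ₗ[ℂ] Skew Γ Θ :=
  (toSkew Γ Θ).toLinearMap ∘ₗ
    (TensorProduct.map Γ.d LinearMap.id + TensorProduct.map Γ.parity Θ.d) ∘ₗ
      (toSkew Γ Θ).symm.toLinearMap

/-- The elements of total degree `n` of the skew tensor product. -/
def skewDegree (n : ℕ) : Submodule ℂ (Skew Γ Θ) :=
  ⨆ p : {p : ℕ × ℕ // p.1 + p.2 = n},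
    (LinearMap.range (TensorProduct.map (Γ.grading p.1.1).subtype
      (Θ.grading p.1.2).subtype)).map (toSkew Γ Θ).toLinearMap

/-- The embedding of `A ⊗ H` into `Γ(A) ⊗̂ Γ(H)` as the component of degree zero. -/
def skewIncl : A ⊗[ℂ] H →ₗ[ℂ] Skew Γ Θ :=
  (toSkew Γ Θ).toLinearMap ∘ₗ TensorProduct.map Γ.incl.toLinearMap Θ.incl.toLinearMap

/-- The horizontal forms `Γ(A) ⊗̂ H` of `Γ(A) ⊗̂ Γ(H)`. -/
def skewHor : Submodule ℂ (Skew Γ Θ) :=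
  (LinearMap.range (Θ.incl.toLinearMap.lTensor Γ.carrier)).map (toSkew Γ Θ).toLinearMap

/-- The canonical connection of the trivial bundle: the projection `hor_c` onto `Γ(A) ⊗̂ H` which
annihilates `γ ⊗̂ θ` for `θ` of positive degree. -/
def horCanonical : Skew Γ Θ →ₗ[ℂ] Skew Γ Θ :=
  (toSkew Γ Θ).toLinearMap ∘ₗ Θ.projZero.lTensor Γ.carrier ∘ₗ (toSkew Γ Θ).symm.toLinearMap

/-- The map `id ⊗ ε : Γ(A) ⊗̂ H → Γ(A)` on horizontal forms, extended by zero to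
`γ ⊗̂ θ` for `θ` of positive degree. -/
def idCounit : Skew Γ Θ →ₗ[ℂ] Γ.carrier :=
  (TensorProduct.rid ℂ Γ.carrier).toLinearMap ∘ₗ
    (Coalgebra.counit (R := ℂ) (A := H) ∘ₗ Θ.degreeZero).lTensor Γ.carrier ∘ₗ
      (toSkew Γ Θ).symm.toLinearMap

variable {Θ} in
/-- The coaction `id ⊗ Δ^Γ` on `Γ(A) ⊗̂ Γ(H)`. -/
def skewCoact (c : RightCovariant Θ) : Skew Γ Θ →ₗ[ℂ] Skew Γ Θ ⊗[ℂ] H :=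
  (toSkew Γ Θ).toLinearMap.rTensor H ∘ₗ
    (TensorProduct.assoc ℂ Γ.carrier Θ.carrier H).symm.toLinearMap ∘ₗ
      c.coact.toLinearMap.lTensor Γ.carrier ∘ₗ (toSkew Γ Θ).symm.toLinearMap

theorem skew_induction {p : Skew Γ Θ → Prop} (x : Skew Γ Θ)
    (tmul : ∀ (a : Γ.carrier) (b : Θ.carrier), p (toSkew Γ Θ (a ⊗ₜ b)))
    (add : ∀ x y, p x → p y → p (x + y)) : p x := by
  obtain ⟨t, rfl⟩ := (toSkew Γ Θ).surjective x
  induction t with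
  | zero => simpa using tmul 0 0
  | tmul a b => exact tmul a b
  | add s t hs ht => rw [map_add]; exact add _ _ hs ht

/-- The product of the skew tensor product in terms of the grading involution. -/
theorem skew_mul {n : ℕ} (a : Γ.carrier) (b : Θ.carrier) {a' : Γ.carrier}
    (ha' : a' ∈ Γ.grading n) (b' : Θ.carrier) :
    toSkew Γ Θ (a ⊗ₜ b) * toSkew Γ Θ (a' ⊗ₜ b') =
      toSkew Γ Θ ((a * a') ⊗ₜ ((Θ.parity ^ n) b * b')) := by
  induction b using Θ.induction_homogeneous with
  | add b c hb hc =>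
    simp only [TensorProduct.tmul_add, map_add, add_mul, hb, hc]
  | hom m b hb =>
    have h := GradedTensorProduct.tmul_coe_mul_coe_tmul (R := ℂ) (𝒜 := Γ.grading)
      (ℬ := Θ.grading) a ⟨b, hb⟩ ⟨a', ha'⟩ b'
    have hp : (Θ.parity ^ n) b = ((-1 : ℂ) ^ (m * n)) • b := by
      rw [pow_mul]
      clear h ha'
      induction n with
      | zero => simp
      | succ n ih =>
        rw [pow_succ', Module.End.mul_apply, ih, map_smul, Θ.parity_of_mem hb, smul_smul,
          pow_succ]
    refine h.trans ?_
    rw [hp, smul_mul_assoc, TensorProduct.tmul_smul, map_smul]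
    rcases Nat.even_or_odd (m * n) with he | he <;>
      simp [he.neg_one_pow]

theorem skew_mul_zero (a a' : Γ.carrier) {b : Θ.carrier} (hb : b ∈ Θ.grading 0)
    (b' : Θ.carrier) :
    toSkew Γ Θ (a ⊗ₜ b) * toSkew Γ Θ (a' ⊗ₜ b') = toSkew Γ Θ ((a * a') ⊗ₜ (b * b')) := by
  induction a' using Γ.induction_homogeneous with
  | add c d hc hd => simp only [TensorProduct.add_tmul, map_add, mul_add, hc, hd]
  | hom n a' ha' =>
    have hp : (Θ.parity ^ n) b = b := by
      clear ha'
      induction n with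
      | zero => simp
      | succ n ih => rw [pow_succ', Module.End.mul_apply, ih, Θ.parity_of_mem hb]; simp
    rw [skew_mul Γ Θ a b ha' b', hp]

variable {Θ} in
theorem skewCoact_mul (c : RightCovariant Θ) (x y : Skew Γ Θ) :
    skewCoact Γ c (x * y) = skewCoact Γ c x * skewCoact Γ c y := by
  have hc (a : Γ.carrier) (b : Θ.carrier) : skewCoact Γ c (toSkew Γ Θ (a ⊗ₜ b)) =
      (toSkew Γ Θ).toLinearMap.rTensor H
        ((TensorProduct.assoc ℂ Γ.carrier Θ.carrier H).symm (a ⊗ₜ c.coact b)) := rfl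
  have key (n : ℕ) (a a' : Γ.carrier) (ha' : a' ∈ Γ.grading n) (t t' : Θ.carrier ⊗[ℂ] H) :
      (toSkew Γ Θ).toLinearMap.rTensor H ((TensorProduct.assoc ℂ Γ.carrier Θ.carrier H).symm
        ((a * a') ⊗ₜ ((Θ.parity ^ n).rTensor H t * t'))) =
      (toSkew Γ Θ).toLinearMap.rTensor H
        ((TensorProduct.assoc ℂ Γ.carrier Θ.carrier H).symm (a ⊗ₜ t)) *
      (toSkew Γ Θ).toLinearMap.rTensor H
        ((TensorProduct.assoc ℂ Γ.carrier Θ.carrier H).symm (a' ⊗ₜ t')) := by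
    induction t with
    | zero => simp
    | add s t hs ht => simp only [map_add, add_mul, TensorProduct.tmul_add, hs, ht]
    | tmul b h =>
      induction t' with
      | zero => simp
      | add s t hs ht => simp only [map_add, mul_add, TensorProduct.tmul_add, hs, ht]
      | tmul b' h' =>
        simp only [LinearMap.rTensor_tmul, Algebra.TensorProduct.tmul_mul_tmul,
          TensorProduct.assoc_symm_tmul, LinearEquiv.coe_coe]
        rw [skew_mul Γ Θ a b ha' b']
  have hpow (n : ℕ) (b : Θ.carrier) :
      c.coact ((Θ.parity ^ n) b) = (Θ.parity ^ n).rTensor H (c.coact b) := by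
    induction n with
    | zero =>
      rw [pow_zero, Module.End.one_apply, Module.End.one_eq_id, LinearMap.rTensor_id,
        LinearMap.id_apply]
    | succ n ih =>
      rw [pow_succ', Module.End.mul_apply, coact_parity, ih, ← LinearMap.comp_apply,
        ← LinearMap.rTensor_comp]
      rfl
  induction x using skew_induction with
  | add x x' hx hx' => simp only [add_mul, map_add, hx, hx']
  | tmul a b =>
    induction y using skew_induction with
    | add y y' hy hy' => simp only [mul_add, map_add, hy, hy']
    | tmul a' b' =>
      induction a' using Γ.induction_homogeneous with
      | add a' a'' h h' => simp only [TensorProduct.add_tmul, map_add, mul_add, h, h']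
      | hom n a' ha' =>
        rw [skew_mul Γ Θ a b ha' b', hc, hc, hc, map_mul, hpow, key n a a' ha']

theorem skewIncl_mem_skewHor (t : A ⊗[ℂ] H) : skewIncl Γ Θ t ∈ skewHor Γ Θ := by
  refine ⟨_, ⟨Γ.incl.toLinearMap.rTensor H t, rfl⟩, ?_⟩
  rw [← LinearMap.comp_apply (Θ.incl.toLinearMap.lTensor Γ.carrier),
    LinearMap.lTensor_comp_rTensor]
  rfl

theorem skewHor_mul {x y : Skew Γ Θ} (hx : x ∈ skewHor Γ Θ) (hy : y ∈ skewHor Γ Θ) :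
    x * y ∈ skewHor Γ Θ := by
  obtain ⟨_, ⟨s, rfl⟩, rfl⟩ := hx
  obtain ⟨_, ⟨t, rfl⟩, rfl⟩ := hy
  induction s with
  | zero => simp
  | add s s' hs hs' => simp only [map_add, add_mul]; exact Submodule.add_mem _ hs hs'
  | tmul a h =>
    induction t with
    | zero => simp
    | add s s' hs hs' => simp only [map_add, mul_add]; exact Submodule.add_mem _ hs hs'
    | tmul a' h' =>
      refine ⟨_, ⟨(a * a') ⊗ₜ (h * h'), rfl⟩, ?_⟩
      simp only [LinearMap.lTensor_tmul, LinearEquiv.coe_coe, AlgHom.toLinearMap_apply]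
      rw [skew_mul_zero Γ Θ a a' (Θ.incl_mem h), map_mul]

/-- The embedding `γ ↦ γ ⊗̂ 1` of `Γ(A)` into `Γ(A) ⊗̂ Γ(H)`. -/
abbrev skewLeft : Γ.carrier →ₐ[ℂ] Skew Γ Θ := GradedTensorProduct.includeLeft Γ.grading Θ.grading

theorem skewLeft_apply (a : Γ.carrier) : skewLeft Γ Θ a = toSkew Γ Θ (a ⊗ₜ 1) := rfl

theorem skewLeft_mem_skewHor (a : Γ.carrier) : skewLeft Γ Θ a ∈ skewHor Γ Θ :=
  ⟨_, ⟨a ⊗ₜ 1, rfl⟩, by simp⟩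

theorem skewLeft_incl (a : A) : skewLeft Γ Θ (Γ.incl a) = skewIncl Γ Θ (a ⊗ₜ 1) := by
  simp [skewIncl]

theorem skewD_skewLeft (a : Γ.carrier) : skewD Γ Θ (skewLeft Γ Θ a) = skewLeft Γ Θ (Γ.d a) := by
  simp [skewD, Θ.d_one]

variable {Θ}

theorem skewCoact_skewIncl (c : RightCovariant Θ) (t : A ⊗[ℂ] H) :
    skewCoact Γ c (skewIncl Γ Θ t) = (skewIncl Γ Θ).rTensor H
      ((TensorProduct.assoc ℂ A H H).symm
        ((Coalgebra.comul (R := ℂ) (A := H)).lTensor A t)) := by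
  induction t with
  | zero => simp
  | add s t hs ht => simp only [map_add, hs, ht]
  | tmul a h =>
    simp only [skewCoact, skewIncl, LinearMap.comp_apply, LinearEquiv.coe_coe,
      LinearEquiv.symm_apply_apply, TensorProduct.map_tmul, LinearMap.lTensor_tmul,
      AlgHom.toLinearMap_apply, c.coact_incl]
    generalize Coalgebra.comul (R := ℂ) h = t
    induction t with
    | zero => simp
    | add s t hs ht => simp only [map_add, TensorProduct.tmul_add, hs, ht]
    | tmul h k => simp

theorem skewCoact_skewD_skewIncl (c : RightCovariant Θ) (t : A ⊗[ℂ] H) :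
    skewCoact Γ c (skewD Γ Θ (skewIncl Γ Θ t)) = (skewD Γ Θ ∘ₗ skewIncl Γ Θ).rTensor H
      ((TensorProduct.assoc ℂ A H H).symm
        ((Coalgebra.comul (R := ℂ) (A := H)).lTensor A t)) := by
  induction t with
  | zero => simp
  | add s t hs ht => simp only [map_add, hs, ht]
  | tmul a h =>
    simp only [skewCoact, skewIncl, skewD, LinearMap.comp_apply, LinearEquiv.coe_coe,
      LinearEquiv.symm_apply_apply, TensorProduct.map_tmul, LinearMap.lTensor_tmul,
      AlgHom.toLinearMap_apply, c.coact_incl, c.coact_d, LinearMap.add_apply, map_add,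
      LinearMap.id_apply]
    generalize Coalgebra.comul (R := ℂ) h = t
    induction t with
    | zero => simp
    | add s t hs ht =>
      simp only [map_add, TensorProduct.tmul_add] at hs ht ⊢
      rw [← hs, ← ht]
      abel
    | tmul h k => simp [TensorProduct.add_tmul]

/-- Evaluation of the second factor of a tensor product against a functional. -/
def slice (V : Type*) [AddCommGroup V] [Module ℂ V] (f : H →ₗ[ℂ] ℂ) : V ⊗[ℂ] H →ₗ[ℂ] V :=
  (TensorProduct.rid ℂ V).toLinearMap ∘ₗ f.lTensor V

theorem slice_rTensor {V W : Type*} [AddCommGroup V] [Module ℂ V] [AddCommGroup W] [Module ℂ W]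
    (f : H →ₗ[ℂ] ℂ) (g : V →ₗ[ℂ] W) (t : V ⊗[ℂ] H) :
    slice W f (g.rTensor H t) = g (slice V f t) := by
  induction t with
  | zero => simp
  | add s t hs ht => simp only [map_add, hs, ht]
  | tmul v h => simp [slice]

/-- An element of `V ⊗ H` all of whose slices lie in a subspace `W` of `V` belongs to `W ⊗ H`. -/
theorem mem_range_of_slice {V : Type*} [AddCommGroup V] [Module ℂ V] (W : Submodule ℂ V)
    (t : V ⊗[ℂ] H) (ht : ∀ f : H →ₗ[ℂ] ℂ, slice V f t ∈ W) :
    t ∈ LinearMap.range (W.subtype.rTensor H) := by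
  have hex : Function.Exact (W.subtype.rTensor H) (W.mkQ.rTensor H) :=
    rTensor_exact H (LinearMap.exact_subtype_mkQ W) W.mkQ_surjective
  refine (hex t).1 ?_
  have h0 (f : H →ₗ[ℂ] ℂ) : slice (V ⧸ W) f (W.mkQ.rTensor H t) = 0 := by
    rw [slice_rTensor]
    simpa using ht f
  generalize W.mkQ.rTensor H t = s at h0
  classical
  let b := Module.Basis.ofVectorSpace ℂ H
  apply (TensorProduct.equivFinsuppOfBasisRight b).injective
  rw [map_zero]
  ext i
  refine Eq.trans ?_ (h0 (b.coord i))
  clear h0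
  induction s with
  | zero => simp
  | add s t hs ht => simp only [map_add, Finsupp.add_apply, hs, ht]
  | tmul v h => simp [slice]

theorem slice_skewCoact_mem_skewHor (c : RightCovariant Θ) (f : H →ₗ[ℂ] ℂ) {x : Skew Γ Θ}
    (hx : x ∈ skewHor Γ Θ) : slice _ f (skewCoact Γ c x) ∈ skewHor Γ Θ := by
  obtain ⟨_, ⟨s, rfl⟩, rfl⟩ := hx
  induction s with
  | zero => simp
  | add s s' hs hs' => simp only [map_add]; exact Submodule.add_mem _ hs hs'
  | tmul a h =>
    simp only [skewCoact, LinearMap.comp_apply, LinearEquiv.coe_coe,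
      LinearEquiv.symm_apply_apply, LinearMap.lTensor_tmul,
      AlgHom.toLinearMap_apply, c.coact_incl]
    generalize Coalgebra.comul (R := ℂ) h = t
    induction t with
    | zero => simp
    | add s t hs ht =>
      simp only [map_add, TensorProduct.tmul_add]; exact Submodule.add_mem _ hs ht
    | tmul h k =>
      simp only [LinearMap.rTensor_tmul, TensorProduct.assoc_symm_tmul, slice,
        LinearMap.comp_apply, LinearMap.lTensor_tmul, LinearEquiv.coe_coe,
        TensorProduct.rid_tmul]
      exact Submodule.smul_mem _ _ ⟨_, ⟨a ⊗ₜ h, rfl⟩, rfl⟩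

end Skew

/-! ### Coverings -/

/-- A family of ideals of `A` is a complete covering if the intersection of the ideals vanishes and
`A` maps onto the gluing of the quotients `A/Jᵢ` along the `A/(Jᵢ + Jⱼ)`. -/
def IsCompleteCovering {I A : Type*} [Ring A] (J : I → Ideal A) : Prop :=
  ⨅ i, J i = ⊥ ∧
    ∀ b : I → A, (∀ i j, b i - b j ∈ J i ⊔ J j) → ∃ a, ∀ i, a - b i ∈ J i

section Completion

variable {I : Type*} {E : I → Type*} [∀ i, Ring (E i)] [∀ i, Algebra ℂ (E i)]

/-- The ideal of elements of `S ⊆ ∏ Eᵢ` whose `i`-th component vanishes. -/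
def coveringIdeal (S : Subalgebra ℂ (∀ i, E i)) (i : I) : Ideal S :=
  RingHom.ker ((Pi.evalAlgHom ℂ E i).comp S.val)

/-- The covering completion of an algebra `S ⊆ ∏ Eᵢ` that maps onto every `Eᵢ`, with respect to the
kernels `Kᵢ` of the projections to the `Eᵢ`. The quotient `S/Kᵢ` is identified with `Eᵢ`; the
families `(xᵢ)` belonging to the completion are those for which `xᵢ` and `xⱼ` agree in
`S/(Kᵢ + Kⱼ)`. -/
def coveringCompletion (S : Subalgebra ℂ (∀ i, E i)) : Subalgebra ℂ (∀ i, E i) where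
  carrier := {x | ∃ g : I → S, (∀ i, (g i : ∀ i, E i) i = x i) ∧
    ∀ i j, g i - g j ∈ coveringIdeal S i ⊔ coveringIdeal S j}
  mul_mem' := by
    rintro x y ⟨g, hg, hg'⟩ ⟨k, hk, hk'⟩
    refine ⟨fun i => g i * k i, fun i => by simp [hg, hk], fun i j => ?_⟩
    have h1 : (g i - g j) * k i ∈ coveringIdeal S i ⊔ coveringIdeal S j := by
      obtain ⟨a, ha, b, hb, hab⟩ := Submodule.mem_sup.1 (hg' i j)
      rw [← hab, add_mul]
      refine Submodule.add_mem_sup ?_ ?_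
      · rw [coveringIdeal, RingHom.mem_ker] at ha ⊢
        rw [map_mul, ha, zero_mul]
      · rw [coveringIdeal, RingHom.mem_ker] at hb ⊢
        rw [map_mul, hb, zero_mul]
    have h2 : g j * (k i - k j) ∈ coveringIdeal S i ⊔ coveringIdeal S j :=
      Ideal.mul_mem_left _ _ (hk' i j)
    have h3 : g i * k i - g j * k j = (g i - g j) * k i + g j * (k i - k j) := by
      rw [sub_mul, mul_sub]
      abel
    rw [h3]
    exact Ideal.add_mem _ h1 h2
  add_mem' := by
    rintro x y ⟨g, hg, hg'⟩ ⟨k, hk, hk'⟩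
    refine ⟨fun i => g i + k i, fun i => by simp [hg, hk], fun i j => ?_⟩
    rw [add_sub_add_comm]
    exact Ideal.add_mem _ (hg' i j) (hk' i j)
  algebraMap_mem' r := ⟨fun _ => algebraMap ℂ S r, fun _ => rfl, fun _ _ => by simp⟩

theorem le_coveringCompletion (S : Subalgebra ℂ (∀ i, E i)) : S ≤ coveringCompletion S :=
  fun x hx => ⟨fun _ => ⟨x, hx⟩, fun _ => rfl, fun _ _ => by simp⟩

end Completion

/-! ### Locally trivial quantum principal fibre bundles -/

/-- A locally trivial quantum principal fibre bundle with base `B`, structure group `H` and total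
space `P`. The index set of the covering is finite. -/
structure LocallyTrivialQPFB (I B H P : Type*) [Ring B] [Algebra ℂ B] [Ring H]
    [HopfAlgebra ℂ H] [Ring P] [Algebra ℂ P] where
  /-- the coaction `Δ_P` -/
  coaction : RightCoaction H P
  /-- the covering of the base -/
  J : I → Ideal B
  [twoSided : ∀ i, (J i).IsTwoSided]
  complete_base : IsCompleteCovering J
  /-- the local trivializations -/
  χ : ∀ i, P →ₐ[ℂ] (B ⧸ J i) ⊗[ℂ] H
  χ_surjective : ∀ i, Function.Surjective (χ i)
  /-- the embedding of the base -/
  ι : B →ₐ[ℂ] P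
  ι_injective : Function.Injective ι
  χ_coact : ∀ (i : I) (p : P),
    (Coalgebra.comul (R := ℂ) (A := H)).lTensor (B ⧸ J i) (χ i p) =
      TensorProduct.assoc ℂ (B ⧸ J i) H H ((χ i).toLinearMap.rTensor H (coaction.coact p))
  χ_ι : ∀ (i : I) (b : B), χ i (ι b) = Ideal.Quotient.mk (J i) b ⊗ₜ 1
  complete_total : IsCompleteCovering fun i => RingHom.ker (χ i)
  range_ι : ∀ p : P, p ∈ Set.range ι ↔ coaction.coact p = p ⊗ₜ 1

attribute [instance] LocallyTrivialQPFB.twoSided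

set_option linter.checkUnivs false in
/-- The data determining a differential structure on a locally trivial bundle: differential calculi
`Γ(Bᵢ)` over the algebras `Bᵢ = B/Jᵢ`, and a right covariant differential calculus `Γ(H)`. -/
structure DifferentialStructure {I B H P : Type*} [Ring B] [Algebra ℂ B] [Ring H]
    [HopfAlgebra ℂ H] [Ring P] [Algebra ℂ P] (Q : LocallyTrivialQPFB I B H P) where
  calcB : ∀ i, DifferentialCalculus.{_, v} (B ⧸ Q.J i)
  calcH : DifferentialCalculus.{_, x} H
  covariant : RightCovariant calcH

namespace DifferentialStructure

variable {I B H P : Type*} [Ring B] [Algebra ℂ B] [Ring H]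
  [HopfAlgebra ℂ H] [Ring P] [Algebra ℂ P] {Q : LocallyTrivialQPFB I B H P}
  (G : DifferentialStructure Q)

/-- The local calculus `Γ(Bᵢ) ⊗̂ Γ(H)`. -/
abbrev Local (i : I) : Type _ := Skew (G.calcB i) G.calcH

/-- The direct sum of the local calculi. -/
abbrev Total : Type _ := ∀ i, G.Local i

/-- The differential on the direct sum of the local calculi. -/
def dTotal : G.Total →ₗ[ℂ] G.Total :=
  LinearMap.pi fun i => skewD (G.calcB i) G.calcH ∘ₗ LinearMap.proj i

/-- The map `p ↦ (χᵢ(p))ᵢ` from `P` to the direct sum of the local calculi. -/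
def χTotal : P →ₗ[ℂ] G.Total :=
  LinearMap.pi fun i => skewIncl (G.calcB i) G.calcH ∘ₗ (Q.χ i).toLinearMap

/-- The differential calculus `Γ(P) = Ω(P)/⋂ᵢ ker χᵢ`, where `χᵢ` here denotes the extension
`Ω(P) → Γ(Bᵢ) ⊗̂ Γ(H)` to the universal calculus. It is realized as the image of `Ω(P)` in the
direct sum of the local calculi under `(χᵢ)ᵢ`, the subalgebra generated by the images of all `p`
and `dp`. The extension of `χᵢ` to `Γ(P)` is the `i`-th projection. -/
def gammaP : Subalgebra ℂ G.Total :=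
  Algebra.adjoin ℂ (Set.range G.χTotal ∪ Set.range fun p => G.dTotal (G.χTotal p))

/-- The covering completion `Γ_c(P)`. -/
def gammaCP : Subalgebra ℂ G.Total := coveringCompletion G.gammaP

/-- The direct sum of the calculi `Γ(Bᵢ)`. -/
abbrev TotalB : Type _ := ∀ i, (G.calcB i).carrier

/-- The differential on the direct sum of the calculi `Γ(Bᵢ)`. -/
def dTotalB : G.TotalB →ₗ[ℂ] G.TotalB :=
  LinearMap.pi fun i => (G.calcB i).d ∘ₗ LinearMap.proj i

/-- The map `b ↦ (πᵢ(b))ᵢ` from `B` to the direct sum of the calculi `Γ(Bᵢ)`. -/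
def πTotal : B →ₗ[ℂ] G.TotalB :=
  LinearMap.pi fun i => (G.calcB i).incl.toLinearMap ∘ₗ (Ideal.Quotient.mkₐ ℂ (Q.J i)).toLinearMap

/-- The differential calculus `Γ(B) = Ω(B)/⋂ᵢ ker πᵢ`, realized as the image of `Ω(B)` in the
direct sum of the calculi `Γ(Bᵢ)`. -/
def gammaB : Subalgebra ℂ G.TotalB :=
  Algebra.adjoin ℂ (Set.range G.πTotal ∪ Set.range fun b => G.dTotalB (G.πTotal b))

/-- The covering completion `Γ_c(B)`. -/
def gammaCB : Subalgebra ℂ G.TotalB := coveringCompletion G.gammaB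

/-- The embedding `(γᵢ)ᵢ ↦ (γᵢ ⊗̂ 1)ᵢ`. -/
def embed : G.TotalB →ₐ[ℂ] G.Total :=
  AlgHom.pi fun i => (skewLeft (G.calcB i) G.calcH).comp (Pi.evalAlgHom ℂ _ i)

/-- The horizontal forms `hor Γ_c(P)`. -/
def hor : Subalgebra ℂ G.Total where
  carrier := {x | x ∈ G.gammaCP ∧ ∀ i, x i ∈ skewHor (G.calcB i) G.calcH}
  mul_mem' hx hy := ⟨mul_mem hx.1 hy.1, fun i => skewHor_mul _ _ (hx.2 i) (hy.2 i)⟩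
  add_mem' hx hy := ⟨add_mem hx.1 hy.1, fun i => Submodule.add_mem _ (hx.2 i) (hy.2 i)⟩
  algebraMap_mem' r := ⟨algebraMap_mem _ r, fun i => by
    have h := skewLeft_mem_skewHor (G.calcB i) G.calcH (algebraMap ℂ _ r)
    rwa [AlgHom.commutes] at h⟩

/-- The elements of degree `n` in the direct sum of the local calculi. -/
def HasDegree (n : ℕ) (x : G.Total) : Prop :=
  ∀ i, x i ∈ skewDegree (G.calcB i) G.calcH n

/-- The elements of degree `n` in the direct sum of the calculi `Γ(Bᵢ)`. -/
def HasDegreeB (n : ℕ) (x : G.TotalB) : Prop :=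
  ∀ i, x i ∈ (G.calcB i).grading n

theorem embed_mem_gammaP {x : G.TotalB} (hx : x ∈ G.gammaB) : G.embed x ∈ G.gammaP := by
  have h1 (b : B) : G.embed (G.πTotal b) = G.χTotal (Q.ι b) := by
    funext i
    change skewLeft _ _ ((G.calcB i).incl _) = skewIncl _ _ (Q.χ i (Q.ι b))
    rw [skewLeft_incl, Q.χ_ι]
    rfl
  have h2 (y : G.TotalB) : G.embed (G.dTotalB y) = G.dTotal (G.embed y) := by
    funext i
    exact (skewD_skewLeft _ _ _).symm
  have : G.gammaB ≤ G.gammaP.comap G.embed := by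
    refine Algebra.adjoin_le ?_
    rintro _ (⟨b, rfl⟩ | ⟨b, rfl⟩)
    · exact Algebra.subset_adjoin (Or.inl ⟨Q.ι b, (h1 b).symm⟩)
    · exact Algebra.subset_adjoin (Or.inr ⟨Q.ι b, by
        change G.dTotal (G.χTotal (Q.ι b)) = G.embed (G.dTotalB (G.πTotal b))
        rw [h2, h1]⟩)
  exact this hx

theorem embed_mem_hor {x : G.TotalB} (hx : x ∈ G.gammaCB) : G.embed x ∈ G.hor := by
  refine ⟨?_, fun i => skewLeft_mem_skewHor _ _ _⟩
  obtain ⟨g, hg, hg'⟩ := hx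
  refine ⟨fun i => ⟨G.embed (g i), G.embed_mem_gammaP (g i).2⟩, fun i => ?_, fun i j => ?_⟩
  · exact congrArg (skewLeft (G.calcB i) G.calcH) (hg i)
  · obtain ⟨a, ha, b, hb, hab⟩ := Submodule.mem_sup.1 (hg' i j)
    refine Submodule.mem_sup.2 ⟨⟨G.embed a, G.embed_mem_gammaP a.2⟩, ?_,
      ⟨G.embed b, G.embed_mem_gammaP b.2⟩, ?_, ?_⟩
    · have ha' : (a : G.TotalB) i = 0 := ha
      change skewLeft (G.calcB i) G.calcH ((a : G.TotalB) i) = 0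
      rw [ha', map_zero]
    · have hb' : (b : G.TotalB) j = 0 := hb
      change skewLeft (G.calcB j) G.calcH ((b : G.TotalB) j) = 0
      rw [hb', map_zero]
    · ext1
      change G.embed a + G.embed b = G.embed (g i) - G.embed (g j)
      rw [← map_add, ← map_sub]
      exact congrArg (fun z : G.gammaB => G.embed z) hab

/-- The embedding `ι_{Γ_c} : Γ_c(B) → hor Γ_c(P)`. -/
def embedHor (γ : G.gammaCB) : G.hor := ⟨G.embed γ, G.embed_mem_hor γ.2⟩

/-- The inclusion of `hor Γ_c(P)` into the direct sum of the local calculi. -/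
def horIncl : G.hor →ₗ[ℂ] G.Total := G.hor.val.toLinearMap

theorem horIncl_rTensor_injective : Function.Injective (G.horIncl.rTensor H) :=
  Module.Flat.rTensor_preserves_injective_linearMap _ Subtype.val_injective

section Coaction

variable [Fintype I] [DecidableEq I]

/-- The coaction `(γᵢ)ᵢ ↦ ((id ⊗ Δ^Γ)(γᵢ))ᵢ` on the direct sum of the local calculi. -/
def coactTotal : G.Total →ₗ[ℂ] G.Total ⊗[ℂ] H :=
  ∑ i, (LinearMap.single ℂ G.Local i).rTensor H ∘ₗ
    skewCoact (G.calcB i) G.covariant ∘ₗ LinearMap.proj i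

theorem slice_coactTotal (f : H →ₗ[ℂ] ℂ) (x : G.Total) (i : I) :
    slice _ f (G.coactTotal x) i = slice _ f (skewCoact (G.calcB i) G.covariant (x i)) := by
  simp only [coactTotal, LinearMap.sum_apply, LinearMap.comp_apply, map_sum, slice_rTensor,
    Finset.sum_apply, LinearMap.proj_apply, LinearMap.single_apply]
  rw [Finset.sum_eq_single i]
  · simp
  · intro j _ hj
    exact Pi.single_eq_of_ne hj.symm _
  · simp

theorem slice_mem_gammaP (f : H →ₗ[ℂ] ℂ) {x : G.Total} (hx : x ∈ G.gammaP) :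
    slice _ f (G.coactTotal x) ∈ G.gammaP := by
  have key : ∃ t : G.gammaP ⊗[ℂ] H, ∀ i, Algebra.TensorProduct.map
      ((Pi.evalAlgHom ℂ G.Local i).comp G.gammaP.val) (AlgHom.id ℂ H) t =
        skewCoact (G.calcB i) G.covariant (x i) := by
    have hgen (u : P →ₗ[ℂ] G.gammaP) (p : P)
        (hu : ∀ i, skewCoact (G.calcB i) G.covariant ((u p : G.Total) i) =
          (LinearMap.proj i ∘ₗ G.gammaP.val.toLinearMap ∘ₗ u).rTensor H (Q.coaction.coact p)) :
        ∃ t : G.gammaP ⊗[ℂ] H, ∀ i, Algebra.TensorProduct.map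
          ((Pi.evalAlgHom ℂ G.Local i).comp G.gammaP.val) (AlgHom.id ℂ H) t =
            skewCoact (G.calcB i) G.covariant ((u p : G.Total) i) := by
      refine ⟨u.rTensor H (Q.coaction.coact p), fun i => ?_⟩
      rw [hu i]
      generalize Q.coaction.coact p = t
      induction t with
      | zero => simp
      | add s t hs ht => simp only [map_add, hs, ht]
      | tmul p h => simp
    have hχ (i : I) (p : P) : (TensorProduct.assoc ℂ (B ⧸ Q.J i) H H).symm
        ((Coalgebra.comul (R := ℂ) (A := H)).lTensor (B ⧸ Q.J i) (Q.χ i p)) =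
          (Q.χ i).toLinearMap.rTensor H (Q.coaction.coact p) := by
      rw [Q.χ_coact, LinearEquiv.symm_apply_apply]
    induction hx using Algebra.adjoin_induction with
    | mem x hx =>
      obtain ⟨p, rfl⟩ | ⟨p, rfl⟩ := hx
      · refine hgen (LinearMap.codRestrict (Subalgebra.toSubmodule G.gammaP) G.χTotal
          fun p => Algebra.subset_adjoin (Or.inl ⟨p, rfl⟩)) p fun i => ?_
        refine (skewCoact_skewIncl _ G.covariant (Q.χ i p)).trans ?_
        rw [hχ, ← LinearMap.comp_apply, ← LinearMap.rTensor_comp]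
        rfl
      · refine hgen (LinearMap.codRestrict (Subalgebra.toSubmodule G.gammaP)
          (G.dTotal ∘ₗ G.χTotal) fun p => Algebra.subset_adjoin (Or.inr ⟨p, rfl⟩)) p fun i => ?_
        refine (skewCoact_skewD_skewIncl _ G.covariant (Q.χ i p)).trans ?_
        rw [hχ, ← LinearMap.comp_apply, ← LinearMap.rTensor_comp]
        rfl
    | algebraMap r =>
      refine ⟨algebraMap ℂ _ r, fun i => ?_⟩
      rw [AlgHom.commutes, Pi.algebraMap_apply, Algebra.algebraMap_eq_smul_one,
        Algebra.algebraMap_eq_smul_one, map_smul]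
      congr 1
      have h := skewCoact_skewIncl (G.calcB i) G.covariant (1 ⊗ₜ 1)
      have h1 : skewIncl (G.calcB i) G.calcH (1 ⊗ₜ 1) = 1 := by
        rw [← skewLeft_incl, map_one, map_one]
      rw [h1] at h
      rw [h]
      simp only [LinearMap.lTensor_tmul, Bialgebra.comul_one, Algebra.TensorProduct.one_def,
        TensorProduct.assoc_symm_tmul, LinearMap.rTensor_tmul, h1]
    | add x y _ _ hx hy =>
      obtain ⟨s, hs⟩ := hx
      obtain ⟨t, ht⟩ := hy
      exact ⟨s + t, fun i => by rw [map_add, hs, ht, Pi.add_apply, map_add]⟩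
    | mul x y _ _ hx hy =>
      obtain ⟨s, hs⟩ := hx
      obtain ⟨t, ht⟩ := hy
      exact ⟨s * t, fun i => by rw [map_mul, hs, ht, Pi.mul_apply, skewCoact_mul]⟩
  obtain ⟨t, ht⟩ := key
  have : slice _ f (G.coactTotal x) = (slice G.gammaP f t : G.gammaP) := by
    funext i
    rw [slice_coactTotal, ← ht i]
    exact slice_rTensor f ((Pi.evalAlgHom ℂ G.Local i).comp G.gammaP.val).toLinearMap t
  rw [this]
  exact Subtype.coe_prop _

theorem slice_mem_hor (f : H →ₗ[ℂ] ℂ) {x : G.Total} (hx : x ∈ G.hor) :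
    slice _ f (G.coactTotal x) ∈ G.hor := by
  refine ⟨?_, fun i => ?_⟩
  · obtain ⟨g, hg, hg'⟩ := hx.1
    refine ⟨fun i => ⟨_, G.slice_mem_gammaP f (g i).2⟩, fun i => ?_, fun i j => ?_⟩
    · refine (G.slice_coactTotal f _ i).trans ?_
      rw [slice_coactTotal, hg]
    · obtain ⟨a, ha, b, hb, hab⟩ := Submodule.mem_sup.1 (hg' i j)
      refine Submodule.mem_sup.2 ⟨⟨_, G.slice_mem_gammaP f a.2⟩, ?_,
        ⟨_, G.slice_mem_gammaP f b.2⟩, ?_, ?_⟩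
      · have ha' : (a : G.Total) i = 0 := ha
        change slice _ f (G.coactTotal (a : G.Total)) i = 0
        rw [slice_coactTotal, ha', map_zero, map_zero]
      · have hb' : (b : G.Total) j = 0 := hb
        change slice _ f (G.coactTotal (b : G.Total)) j = 0
        rw [slice_coactTotal, hb', map_zero, map_zero]
      · ext1
        change slice _ f (G.coactTotal a) + slice _ f (G.coactTotal b) =
          slice _ f (G.coactTotal (g i)) - slice _ f (G.coactTotal (g j))
        rw [← map_add, ← map_add, ← map_sub, ← map_sub]
        exact congrArg (fun z : G.gammaP => slice _ f (G.coactTotal z)) hab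
  · rw [slice_coactTotal]
    exact slice_skewCoact_mem_skewHor _ _ f (hx.2 i)

/-- The coaction `hor Γ_c(P) → hor Γ_c(P) ⊗ H`, the restriction of `coactTotal`. -/
def coactHor : G.hor →ₗ[ℂ] G.hor ⊗[ℂ] H :=
  (LinearEquiv.ofInjective _ G.horIncl_rTensor_injective).symm.toLinearMap ∘ₗ
    LinearMap.codRestrict _ (G.coactTotal ∘ₗ G.horIncl) fun x =>
      mem_range_of_slice (Subalgebra.toSubmodule G.hor) _ fun f => G.slice_mem_hor f x.2

theorem coactHor_eq (α : G.hor) : G.horIncl.rTensor H (G.coactHor α) = G.coactTotal α := by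
  have h := LinearEquiv.apply_symm_apply
    (LinearEquiv.ofInjective _ (G.horIncl_rTensor_injective (H := H)))
    (LinearMap.codRestrict _ (G.coactTotal ∘ₗ G.horIncl) (fun x =>
      mem_range_of_slice (Subalgebra.toSubmodule G.hor) _ fun f => G.slice_mem_hor f x.2) α)
  exact congrArg Subtype.val h

/-! ### Covariant derivatives, pre-connection forms and curvature -/

/-- The conditions common to left and right covariant derivatives on `hor Γ_c(P)`. -/
structure IsCovariantDerivativeBase (D : G.hor →ₗ[ℂ] G.hor) : Prop where
  degree : ∀ (n : ℕ) (α : G.hor), G.HasDegree n α → G.HasDegree (n + 1) (D α)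
  map_one : D 1 = 0
  covariant : ∀ α : G.hor, D.rTensor H (G.coactHor α) = G.coactHor (D α)
  localized : ∀ (i : I) (α : G.hor), (α : G.Total) i = 0 → (D α : G.Total) i = 0

/-- Left covariant derivatives on `hor Γ_c(P)`. -/
structure IsLeftCovariantDerivative (D : G.hor →ₗ[ℂ] G.hor) : Prop
    extends G.IsCovariantDerivativeBase D where
  leibniz : ∀ (n : ℕ) (γ : G.gammaCB) (α : G.hor), G.HasDegreeB n γ →
    (D (G.embedHor γ * α) : G.Total) =
      G.dTotal (G.embed γ) * α + (-1 : ℂ) ^ n • (G.embed γ * D α)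

/-- Right covariant derivatives on `hor Γ_c(P)`. -/
structure IsRightCovariantDerivative (D : G.hor →ₗ[ℂ] G.hor) : Prop
    extends G.IsCovariantDerivativeBase D where
  leibniz : ∀ (n : ℕ) (γ : G.gammaCB) (α : G.hor), G.HasDegree n α →
    (D (α * G.embedHor γ) : G.Total) =
      D α * G.embed γ + (-1 : ℂ) ^ n • (α * G.dTotal (G.embed γ))

/-- A linear map `ω : H → Γ_c(P)`, viewed as a map to the direct sum of the local calculi. -/
def toTotal (ω : H →ₗ[ℂ] G.gammaCP) : H →ₗ[ℂ] G.Total := G.gammaCP.val.toLinearMap ∘ₗ ω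

/-- Left pre-connection forms. -/
structure IsLeftPreConnectionForm (ω : H →ₗ[ℂ] G.gammaCP) : Prop where
  degree : ∀ h : H, G.HasDegree 1 (ω h)
  map_one : ω 1 = 0
  covariant : ∀ h : H, G.coactTotal (ω h) = (G.toTotal ω).rTensor H (adLeft h)
  vertical : ∀ (i : I) (h : H),
    (ω h : G.Total) i - horCanonical (G.calcB i) G.calcH ((ω h : G.Total) i) =
      - toSkew (G.calcB i) G.calcH (1 ⊗ₜ maurerCartanLeft G.calcH h)

/-- Right pre-connection forms. -/
structure IsRightPreConnectionForm (hS : Function.Bijective (HopfAlgebra.antipode ℂ (A := H)))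
    (ω : H →ₗ[ℂ] G.gammaCP) : Prop where
  degree : ∀ h : H, G.HasDegree 1 (ω h)
  map_one : ω 1 = 0
  covariant : ∀ h : H, G.coactTotal (ω h) = (G.toTotal ω).rTensor H (adRight hS h)
  vertical : ∀ (i : I) (h : H),
    (ω h : G.Total) i - horCanonical (G.calcB i) G.calcH ((ω h : G.Total) i) =
      - toSkew (G.calcB i) G.calcH (1 ⊗ₜ maurerCartanRight G.calcH hS h)

end Coaction

/-- The local form `Aᵢ(h) = -(id ⊗ ε) hor_c (χᵢ(ω(h)))` of a pre-connection form `ω`. -/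
def localForm (ω : H →ₗ[ℂ] G.gammaCP) (i : I) : H →ₗ[ℂ] (G.calcB i).carrier :=
  -(idCounit (G.calcB i) G.calcH ∘ₗ horCanonical (G.calcB i) G.calcH ∘ₗ LinearMap.proj i ∘ₗ
    G.toTotal ω)

/-- `A = Aᵢ` is the `i`-th local form of the covariant derivative `D`, that is,
`Aᵢ(h) = -(id ⊗ ε)(Dᵢ(1 ⊗ h))`, where the map `Dᵢ` on `Γ(Bᵢ) ⊗̂ H` is defined by
`Dᵢ ∘ χᵢ = χᵢ ∘ D`. -/
def IsLocalForm (D : G.hor →ₗ[ℂ] G.hor) (i : I) (A : H →ₗ[ℂ] (G.calcB i).carrier) : Prop :=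
  ∀ (h : H) (α : G.hor), (α : G.Total) i = skewIncl (G.calcB i) G.calcH (1 ⊗ₜ h) →
    A h = -idCounit (G.calcB i) G.calcH ((D α : G.Total) i)

/-- `ω` and the covariant derivative `D` belong to each other: they have the same local forms. -/
def Corresponds (ω : H →ₗ[ℂ] G.gammaCP) (D : G.hor →ₗ[ℂ] G.hor) : Prop :=
  ∀ i, G.IsLocalForm D i (G.localForm ω i)

/-- The left curvature form `Ω_l(h) = dω_l(h) - ∑ ω_l(h₁) ω_l(h₂)`. -/
def leftCurvatureForm (ω : H →ₗ[ℂ] G.gammaCP) : H →ₗ[ℂ] G.Total :=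
  G.dTotal ∘ₗ G.toTotal ω -
    LinearMap.mul' ℂ G.Total ∘ₗ TensorProduct.map (G.toTotal ω) (G.toTotal ω) ∘ₗ
      Coalgebra.comul (R := ℂ)

/-- The right curvature form `Ω_r(h) = dω_r(h) + ∑ ω_r(h₂) ω_r(h₁)`. -/
def rightCurvatureForm (ω : H →ₗ[ℂ] G.gammaCP) : H →ₗ[ℂ] G.Total :=
  G.dTotal ∘ₗ G.toTotal ω +
    LinearMap.mul' ℂ G.Total ∘ₗ TensorProduct.map (G.toTotal ω) (G.toTotal ω) ∘ₗ
      (TensorProduct.comm ℂ H H).toLinearMap ∘ₗ Coalgebra.comul (R := ℂ)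

/-- `α ⊗ h ↦ α Ω(h)`. -/
def mulRight (Ω : H →ₗ[ℂ] G.Total) : G.hor ⊗[ℂ] H →ₗ[ℂ] G.Total :=
  LinearMap.mul' ℂ G.Total ∘ₗ TensorProduct.map G.hor.val.toLinearMap Ω

/-- `α ⊗ h ↦ Ω(h) α`. -/
def mulLeft (Ω : H →ₗ[ℂ] G.Total) : G.hor ⊗[ℂ] H →ₗ[ℂ] G.Total :=
  LinearMap.mul' ℂ G.Total ∘ₗ TensorProduct.map Ω G.hor.val.toLinearMap ∘ₗ
    (TensorProduct.comm ℂ G.hor H).toLinearMap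

end DifferentialStructure

end QPFB

end

/-! Both sides are families indexed by the covering, so the identity can be checked in one
trivialization `i`. Since `D` preserves `ker χ_i`, it induces a map `E` there, and every horizontal
form in `Γ(B_i) ⊗̂ Γ(H)` is a sum of products `x j(h)` with `x` in `Γ(B_i) ⊗̂ 1` and `j(h) = 1 ⊗̂
h`, two kinds of elements that commute without sign. Let `σ` be the grading involution, `a = A_i ⊗̂
1`, and `*` the convolution of linear maps on `H`.

Covariance and the counit axiom give `E ∘ j = -(a * j)` (`local_skewRight`). The Leibniz rule
extends this to `E(x j(h)) = dx j(h) - σ(x)(a * j)(h)`, and applying `E` twice leaves `-x (da * j +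
a * a * j)(h)` (`left_square`).

On the other side, the vertical part of `ω` in the trivialization is `-(jS * dj)`, and its
horizontal part is forced by covariance to be `-(jS * a * j)`. As `j * jS` is the convolution unit,
these combine into the single relation `j * ω = -(a * j + dj)`
(`IsLeftPreConnectionForm.conv_skewRight`). Differentiating it, and separately multiplying it by `ω`
on the right, gives `j * (dω - ω * ω) = -(da * j + a * a * j)` (`conv_left_curvature`). The coaction
sends `x j(h)` to the sum of `x j(h₁) ⊗ h₂`, so the sum of `γ₀ Ω(γ₁)` is `x (j * Ω)(h)`, and the two
computations meet.

The right case has the same shape with the co-opposite comultiplication and `S⁻¹`: the relation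
becomes `ω * j = -(j * a + dj)`, and the squared derivative is computed from `E(j(h) x) = j(h) dx -
(j * a)(h) x`. -/

noncomputable section

namespace QPFB

/-! ### Convolution calculus and the structure equation in abstract form -/

section Convolution

variable {H : Type*} [AddCommGroup H] [Module ℂ H] {R : Type*} [Ring R] [Algebra ℂ R]

/-- The convolution product `h ↦ ∑ f(h') g(h'')` of linear maps, where `δ(h) = ∑ h' ⊗ h''`. -/
def conv (δ : H →ₗ[ℂ] H ⊗[ℂ] H) (f g : H →ₗ[ℂ] R) : H →ₗ[ℂ] R :=
  LinearMap.mul' ℂ R ∘ₗ TensorProduct.map f g ∘ₗ δ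

variable (δ : H →ₗ[ℂ] H ⊗[ℂ] H) (f f' g g' k : H →ₗ[ℂ] R)

theorem conv_apply (h : H) :
    conv δ f g h = LinearMap.mul' ℂ R (TensorProduct.map f g (δ h)) := rfl

theorem add_conv : conv δ (f + f') g = conv δ f g + conv δ f' g := by
  simp [conv, TensorProduct.map_add_left, LinearMap.comp_add, LinearMap.add_comp]

theorem conv_add : conv δ f (g + g') = conv δ f g + conv δ f g' := by
  simp [conv, TensorProduct.map_add_right, LinearMap.comp_add, LinearMap.add_comp]

theorem neg_conv : conv δ (-f) g = -conv δ f g := by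
  rw [eq_neg_iff_add_eq_zero, ← add_conv, neg_add_cancel]
  simp [conv, TensorProduct.map_zero_left]

theorem conv_neg : conv δ f (-g) = -conv δ f g := by
  rw [eq_neg_iff_add_eq_zero, ← conv_add, neg_add_cancel]
  simp [conv, TensorProduct.map_zero_right]

theorem conv_sub : conv δ f (g - g') = conv δ f g - conv δ f g' := by
  rw [sub_eq_add_neg, conv_add, conv_neg, ← sub_eq_add_neg]

-- Coassociativity of `δ` is the only input, and it is kept as a hypothesis so that the lemma serves
-- both the comultiplication and its co-opposite.
variable {δ} in
theorem conv_assoc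
    (hδ : ∀ h, TensorProduct.assoc ℂ H H H (δ.rTensor H (δ h)) = δ.lTensor H (δ h)) :
    conv δ (conv δ f g) k = conv δ f (conv δ g k) := by
  have h1 (t : H ⊗[ℂ] H) : LinearMap.mul' ℂ R (TensorProduct.map (conv δ f g) k t) =
      LinearMap.mul' ℂ R (TensorProduct.map f (LinearMap.mul' ℂ R ∘ₗ TensorProduct.map g k)
        (TensorProduct.assoc ℂ H H H (δ.rTensor H t))) := by
    induction t with
    | zero => simp
    | add s t hs ht => simp only [map_add, hs, ht]
    | tmul x y =>
      simp only [TensorProduct.map_tmul, LinearMap.mul'_apply, LinearMap.rTensor_tmul, conv_apply]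
      generalize δ x = t
      induction t with
      | zero => simp
      | add s t hs ht => simp only [map_add, TensorProduct.add_tmul, add_mul, hs, ht]
      | tmul u v => simp [mul_assoc]
  have h2 (t : H ⊗[ℂ] H) : LinearMap.mul' ℂ R (TensorProduct.map f (conv δ g k) t) =
      LinearMap.mul' ℂ R (TensorProduct.map f (LinearMap.mul' ℂ R ∘ₗ TensorProduct.map g k)
        (δ.lTensor H t)) := by
    induction t with
    | zero => simp
    | add s t hs ht => simp only [map_add, hs, ht]
    | tmul x y => rfl
  ext h
  rw [conv_apply, conv_apply, h1, h2, hδ]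

/-- A linear map satisfying a twisted Leibniz rule satisfies it for the convolution product. -/
theorem comp_conv {d σ : R →ₗ[ℂ] R} (hd : ∀ x y, d (x * y) = d x * y + σ x * d y) :
    d ∘ₗ conv δ f g = conv δ (d ∘ₗ f) g + conv δ (σ ∘ₗ f) (d ∘ₗ g) := by
  ext h
  simp only [LinearMap.comp_apply, LinearMap.add_apply, conv_apply]
  generalize δ h = t
  induction t with
  | zero => simp
  | add s t hs ht =>
    simp only [map_add, hs, ht]
    abel
  | tmul x y => simp [hd]

theorem conv_mulLeft (x : R) (h : H) :
    conv δ (LinearMap.mulLeft ℂ x ∘ₗ f) g h = x * conv δ f g h := by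
  simp only [conv_apply]
  generalize δ h = t
  induction t with
  | zero => simp
  | add s t hs ht => simp only [map_add, hs, ht, mul_add]
  | tmul y z => simp [mul_assoc]

theorem conv_mulRight (x : R) (h : H) :
    conv δ f (LinearMap.mulRight ℂ x ∘ₗ g) h = conv δ f g h * x := by
  simp only [conv_apply]
  generalize δ h = t
  induction t with
  | zero => simp
  | add s t hs ht => simp only [map_add, hs, ht, add_mul]
  | tmul y z => simp [mul_assoc]

/-- Passes between the left and right conventions: flipping `δ` is harmless when the values commute,
as values in `Γ(B_i) ⊗̂ 1` and `1 ⊗̂ H` do. -/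
theorem conv_comm_comul (h : H) (hfg : ∀ x y, Commute (f x) (g y)) :
    conv ((TensorProduct.comm ℂ H H).toLinearMap ∘ₗ δ) f g h = conv δ g f h := by
  simp only [conv_apply, LinearMap.comp_apply]
  generalize δ h = t
  induction t with
  | zero => simp
  | add s t hs ht => simp only [map_add, hs, ht]
  | tmul y z => simpa using (hfg z y).eq

variable {δ f g} {d σ : R →ₗ[ℂ] R} {j a ω : H →ₗ[ℂ] R}

/-- The left structure equation in a local trivialization. -/
theorem conv_left_curvature
    (hδ : ∀ h, TensorProduct.assoc ℂ H H H (δ.rTensor H (δ h)) = δ.lTensor H (δ h))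
    (hd : ∀ x y, d (x * y) = d x * y + σ x * d y) (hdd : d ∘ₗ d = 0)
    (hj : σ ∘ₗ j = j) (ha : σ ∘ₗ a = -a) (hω : conv δ j ω = -(conv δ a j + d ∘ₗ j)) :
    conv δ j (d ∘ₗ ω - conv δ ω ω) = -(conv δ (d ∘ₗ a) j + conv δ a (conv δ a j)) := by
  have h1 := comp_conv δ j ω hd
  rw [hω, hj, LinearMap.comp_neg, LinearMap.comp_add, ← LinearMap.comp_assoc, hdd,
    comp_conv δ a j hd, ha, neg_conv, LinearMap.zero_comp] at h1
  -- The derivative of `hω`, solved for `j * dω`. The sign before `a * dj` comes from `a` being odd.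
  have h2 : conv δ j (d ∘ₗ ω) = -(conv δ (d ∘ₗ a) j - conv δ a (d ∘ₗ j)) -
      conv δ (d ∘ₗ j) ω := by
    rw [eq_sub_iff_add_eq, add_comm, ← h1]
    abel
  -- `hω` is used twice in `j * ω * ω`, which becomes `a * (a * j + dj) - dj * ω`; the terms `a *
  -- dj` and `dj * ω` cancel against those of `h2`.
  rw [conv_sub, h2, ← conv_assoc _ _ _ hδ, hω, neg_conv, add_conv, conv_assoc _ _ _ hδ, hω,
    conv_neg, conv_add]
  abel

/-- The right structure equation in a local trivialization. -/
theorem conv_right_curvature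
    (hδ : ∀ h, TensorProduct.assoc ℂ H H H (δ.rTensor H (δ h)) = δ.lTensor H (δ h))
    (hd : ∀ x y, d (x * y) = d x * y + σ x * d y) (hdd : d ∘ₗ d = 0)
    (hj : σ ∘ₗ j = j) (hσω : σ ∘ₗ ω = -ω) (hω : conv δ ω j = -(conv δ j a + d ∘ₗ j)) :
    conv δ (d ∘ₗ ω + conv δ ω ω) j = -conv δ j (d ∘ₗ a) + conv δ (conv δ j a) a := by
  have h1 := comp_conv δ ω j hd
  rw [hω, LinearMap.comp_neg, LinearMap.comp_add, ← LinearMap.comp_assoc, hdd,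
    comp_conv δ j a hd, hj, hσω, neg_conv, LinearMap.zero_comp] at h1
  -- Here `d` has to pass `ω` rather than `a`, so it is the oddness of `ω` that enters.
  have h2 : conv δ (d ∘ₗ ω) j = -(conv δ (d ∘ₗ j) a + conv δ j (d ∘ₗ a)) +
      conv δ ω (d ∘ₗ j) := by
    rw [← sub_eq_iff_eq_add, sub_eq_add_neg, ← h1]
    abel
  rw [add_conv, h2, conv_assoc _ _ _ hδ, hω, conv_neg, conv_add, ← conv_assoc _ _ _ hδ, hω,
    neg_conv, add_conv]
  abel

variable {E : R →ₗ[ℂ] R} {S : Submodule ℂ R}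

/-- The square of a left covariant derivative in a local trivialization. -/
theorem left_square
    (hd : ∀ x y, d (x * y) = d x * y + σ x * d y) (hdd : d ∘ₗ d = 0)
    (hσ : ∀ x y, σ (x * y) = σ x * σ y) (hσσ : ∀ x, σ (σ x) = x) (hσd : ∀ x, σ (d x) = -d (σ x))
    (hS : ∀ x ∈ S, ∀ y ∈ S, x * y ∈ S) (hSd : ∀ x ∈ S, d x ∈ S) (hSσ : ∀ x ∈ S, σ x ∈ S)
    (hSa : ∀ h, a h ∈ S) (ha : σ ∘ₗ a = -a)
    (hE : ∀ x ∈ S, ∀ h, E (x * j h) = d x * j h - σ x * conv δ a j h) {x : R} (hx : x ∈ S) (h : H) :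
    E (E (x * j h)) = x * (-(conv δ (d ∘ₗ a) j + conv δ a (conv δ a j))) h := by
  have hdd' (x : R) : d (d x) = 0 := LinearMap.congr_fun hdd x
  -- `E` is known only on products `x j(h)` with `x ∈ S`; summing over the comultiplication makes it
  -- known on `b * j` for any `S`-valued `b`. The second application of `E` needs this with `b =
  -- σ(x) a`.
  have key (b : H →ₗ[ℂ] R) (hb : ∀ h, b h ∈ S) :
      E (conv δ b j h) = conv δ (d ∘ₗ b) j h - conv δ (σ ∘ₗ b) (conv δ a j) h := by
    simp only [conv_apply _ b, conv_apply _ (d ∘ₗ b), conv_apply _ (σ ∘ₗ b)]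
    generalize δ h = t
    induction t with
    | zero => simp
    | add s t hs ht =>
      simp only [map_add, hs, ht]
      abel
    | tmul y z => simp [hE _ (hb y)]
  have hdb : d ∘ₗ LinearMap.mulLeft ℂ (σ x) ∘ₗ a =
      LinearMap.mulLeft ℂ (d (σ x)) ∘ₗ a + LinearMap.mulLeft ℂ x ∘ₗ d ∘ₗ a := by
    ext y
    simp [hd, hσσ]
  have hσb : σ ∘ₗ LinearMap.mulLeft ℂ (σ x) ∘ₗ a = -(LinearMap.mulLeft ℂ x ∘ₗ a) := by
    ext y
    have := LinearMap.congr_fun ha y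
    simp only [LinearMap.comp_apply, LinearMap.neg_apply] at this
    simp [hσ, hσσ, this]
  -- The two terms containing `d(σ x)` cancel, because `σ(dx) = -d(σ x)`. The remaining terms carry
  -- `σ(σ x) = x`.
  rw [hE x hx, map_sub, hE _ (hSd x hx), hdd', ← conv_mulLeft δ _ _ (σ x),
    key _ fun h => by simpa using hS _ (hSσ x hx) _ (hSa h), hdb, hσb, add_conv, neg_conv, hσd]
  simp only [LinearMap.add_apply, LinearMap.neg_apply, conv_mulLeft, mul_neg, mul_add, neg_mul,
    zero_mul]
  abel

/-- The square of a right covariant derivative in a local trivialization. -/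
theorem right_square
    (hd : ∀ x y, d (x * y) = d x * y + σ x * d y) (hdd : d ∘ₗ d = 0)
    (hS : ∀ x ∈ S, ∀ y ∈ S, x * y ∈ S) (hSd : ∀ x ∈ S, d x ∈ S)
    (hSa : ∀ h, a h ∈ S) (ha : σ ∘ₗ a = -a)
    (hE : ∀ x ∈ S, ∀ h, E (j h * x) = j h * d x - conv δ j a h * x) {x : R} (hx : x ∈ S) (h : H) :
    E (E (j h * x)) = (-conv δ j (d ∘ₗ a) + conv δ (conv δ j a) a) h * x := by
  have hdd' (x : R) : d (d x) = 0 := LinearMap.congr_fun hdd x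
  have key (b : H →ₗ[ℂ] R) (hb : ∀ h, b h ∈ S) :
      E (conv δ j b h) = conv δ j (d ∘ₗ b) h - conv δ (conv δ j a) b h := by
    simp only [conv_apply _ _ b, conv_apply _ _ (d ∘ₗ b)]
    generalize δ h = t
    induction t with
    | zero => simp
    | add s t hs ht =>
      simp only [map_add, hs, ht]
      abel
    | tmul y z => simp [hE _ (hb z)]
  -- Since `a` is odd, `d(a x) = (da) x - a dx`; the last term cancels the one obtained by applying
  -- `E` to `j(h) dx`.
  have hdb : d ∘ₗ LinearMap.mulRight ℂ x ∘ₗ a =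
      LinearMap.mulRight ℂ x ∘ₗ d ∘ₗ a - LinearMap.mulRight ℂ (d x) ∘ₗ a := by
    ext y
    have := LinearMap.congr_fun ha y
    simp only [LinearMap.comp_apply, LinearMap.neg_apply] at this
    simp [hd, this, sub_eq_add_neg]
  rw [hE x hx, map_sub, hE _ (hSd x hx), hdd', ← conv_mulRight δ _ _ x,
    key _ fun h => by simpa using hS _ (hSa h) _ hx, hdb, conv_sub]
  simp only [LinearMap.add_apply, LinearMap.sub_apply, LinearMap.neg_apply, conv_mulRight, mul_zero,
    add_mul, neg_mul]
  abel

end Convolution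

/-! ### Convolution inverses from the antipode, and the adjoint coactions -/

section HopfConvolution

variable {H : Type*} [Ring H] [HopfAlgebra ℂ H] {R : Type*} [Ring R] [Algebra ℂ R]

/-- The co-opposite comultiplication `h ↦ ∑ h₂ ⊗ h₁`. -/
def comulOp : H →ₗ[ℂ] H ⊗[ℂ] H :=
  (TensorProduct.comm ℂ H H).toLinearMap ∘ₗ Coalgebra.comul (R := ℂ)

theorem comulOp_coassoc (h : H) :
    TensorProduct.assoc ℂ H H H ((comulOp (H := H)).rTensor H (comulOp h)) =
      (comulOp (H := H)).lTensor H (comulOp h) := by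
  -- The reversal `x ⊗ (u ⊗ v) ↦ v ⊗ (u ⊗ x)`; it carries ordinary coassociativity to the
  -- co-opposite one.
  let rev : H ⊗[ℂ] (H ⊗[ℂ] H) →ₗ[ℂ] H ⊗[ℂ] (H ⊗[ℂ] H) :=
    (TensorProduct.comm ℂ H H).toLinearMap.lTensor H ∘ₗ
      (TensorProduct.leftComm ℂ H H H).toLinearMap ∘ₗ
        (TensorProduct.comm ℂ H H).toLinearMap.lTensor H
  have h1 (t : H ⊗[ℂ] H) : TensorProduct.assoc ℂ H H H
      ((comulOp (H := H)).rTensor H (TensorProduct.comm ℂ H H t)) =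
        rev ((Coalgebra.comul (R := ℂ)).lTensor H t) := by
    induction t with
    | zero => simp
    | add s t hs ht => simp only [map_add, hs, ht]
    | tmul x y =>
      simp only [TensorProduct.comm_tmul, LinearMap.rTensor_tmul, LinearMap.lTensor_tmul, comulOp,
        LinearMap.comp_apply]
      generalize Coalgebra.comul (R := ℂ) y = t
      induction t with
      | zero => simp
      | add s t hs ht => simp only [map_add, TensorProduct.add_tmul, TensorProduct.tmul_add, hs, ht]
      | tmul u v => simp [rev]
  have h2 (t : H ⊗[ℂ] H) : (comulOp (H := H)).lTensor H (TensorProduct.comm ℂ H H t) =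
      rev (TensorProduct.assoc ℂ H H H ((Coalgebra.comul (R := ℂ)).rTensor H t)) := by
    induction t with
    | zero => simp
    | add s t hs ht => simp only [map_add, hs, ht]
    | tmul x y =>
      simp only [TensorProduct.comm_tmul, LinearMap.rTensor_tmul, LinearMap.lTensor_tmul, comulOp,
        LinearMap.comp_apply]
      generalize Coalgebra.comul (R := ℂ) x = t
      induction t with
      | zero => simp
      | add s t hs ht => simp only [map_add, TensorProduct.add_tmul, TensorProduct.tmul_add, hs, ht]
      | tmul u v => simp [rev]
  have h3 : comulOp h = TensorProduct.comm ℂ H H (Coalgebra.comul (R := ℂ) h) := rfl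
  rw [h3, h1, h2, Coalgebra.coassoc_apply]

theorem conv_counit_left (f : H →ₗ[ℂ] R) :
    conv Coalgebra.comul (Algebra.linearMap ℂ R ∘ₗ Coalgebra.counit) f = f := by
  ext h
  have h1 (t : H ⊗[ℂ] H) : LinearMap.mul' ℂ R (TensorProduct.map
      (Algebra.linearMap ℂ R ∘ₗ Coalgebra.counit) f t) = LinearMap.mul' ℂ R (TensorProduct.map
      (Algebra.linearMap ℂ R) f ((Coalgebra.counit (R := ℂ) (A := H)).rTensor H t)) := by
    induction t with
    | zero => simp
    | add s t hs ht => simp only [map_add, hs, ht]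
    | tmul x y => simp
  rw [conv_apply, h1, Coalgebra.rTensor_counit_comul]
  simp

theorem conv_counit_right (f : H →ₗ[ℂ] R) :
    conv comulOp f (Algebra.linearMap ℂ R ∘ₗ Coalgebra.counit) = f := by
  ext h
  refine (conv_comm_comul _ _ _ h fun x y => ?_).trans
    (LinearMap.congr_fun (conv_counit_left f) h)
  exact (Algebra.commutes _ _).symm

/-- Composition with a multiplicative map turns the antipode axiom into a convolution identity. -/
theorem conv_antipode (j : H →ₐ[ℂ] R) :
    conv Coalgebra.comul j.toLinearMap (j.toLinearMap ∘ₗ HopfAlgebra.antipode ℂ) =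
      Algebra.linearMap ℂ R ∘ₗ Coalgebra.counit := by
  ext h
  have h1 (t : H ⊗[ℂ] H) : LinearMap.mul' ℂ R (TensorProduct.map j.toLinearMap
      (j.toLinearMap ∘ₗ HopfAlgebra.antipode ℂ) t) =
        j (LinearMap.mul' ℂ H ((HopfAlgebra.antipode ℂ).lTensor H t)) := by
    induction t with
    | zero => simp
    | add s t hs ht => simp only [map_add, hs, ht]
    | tmul x y => simp
  rw [conv_apply, h1, HopfAlgebra.mul_antipode_lTensor_comul_apply]
  simp

theorem antipode_antipodeInv (hS : Function.Bijective (HopfAlgebra.antipode ℂ (A := H))) (h : H) :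
    HopfAlgebra.antipode ℂ (antipodeInv hS h) = h :=
  LinearEquiv.apply_symm_apply (LinearEquiv.ofBijective _ hS) h

/-- The inverse antipode plays the role of an antipode for the co-opposite comultiplication. -/
theorem conv_antipodeInv (hS : Function.Bijective (HopfAlgebra.antipode ℂ (A := H)))
    (j : H →ₐ[ℂ] R) :
    conv comulOp (j.toLinearMap ∘ₗ antipodeInv hS) j.toLinearMap =
      Algebra.linearMap ℂ R ∘ₗ Coalgebra.counit := by
  have key (h : H) : LinearMap.mul' ℂ H (TensorProduct.map (antipodeInv hS) LinearMap.id
      (comulOp h)) = algebraMap ℂ H (Coalgebra.counit h) := by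
    -- As `S` reverses products, it turns the sum of `S⁻¹(h₂) h₁` into that of `S(h₁) h₂`, where the
    -- antipode axiom applies.
    apply hS.injective
    have h1 (t : H ⊗[ℂ] H) : HopfAlgebra.antipode ℂ (LinearMap.mul' ℂ H
        (TensorProduct.map (antipodeInv hS) LinearMap.id (TensorProduct.comm ℂ H H t))) =
          LinearMap.mul' ℂ H ((HopfAlgebra.antipode ℂ).rTensor H t) := by
      induction t with
      | zero => simp
      | add s t hs ht => simp only [map_add, hs, ht]
      | tmul x y => simp [HopfAlgebra.antipode_mul_antidistrib, antipode_antipodeInv]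
    refine (h1 _).trans ?_
    rw [HopfAlgebra.mul_antipode_rTensor_comul_apply, Algebra.algebraMap_eq_smul_one, map_smul,
      HopfAlgebra.antipode_one]
  ext h
  have h1 (t : H ⊗[ℂ] H) : LinearMap.mul' ℂ R (TensorProduct.map
      (j.toLinearMap ∘ₗ antipodeInv hS) j.toLinearMap t) =
        j (LinearMap.mul' ℂ H (TensorProduct.map (antipodeInv hS) LinearMap.id t)) := by
    induction t with
    | zero => simp
    | add s t hs ht => simp only [map_add, hs, ht]
    | tmul x y => simp
  rw [conv_apply, h1, key]
  simp

/-- Removes the factor `jS` from a formula for `ω`, so that the antipode disappears before any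
differentiation. -/
theorem conv_conv_antipode (j : H →ₐ[ℂ] R) (f : H →ₗ[ℂ] R) :
    conv Coalgebra.comul j.toLinearMap
      (conv Coalgebra.comul (j.toLinearMap ∘ₗ HopfAlgebra.antipode ℂ) f) = f := by
  have h := conv_assoc (R := R) j.toLinearMap (j.toLinearMap ∘ₗ HopfAlgebra.antipode ℂ) f
    (Coalgebra.coassoc_apply (R := ℂ) (A := H))
  rw [← h, conv_antipode, conv_counit_left]

theorem conv_conv_antipodeInv (hS : Function.Bijective (HopfAlgebra.antipode ℂ (A := H)))
    (j : H →ₐ[ℂ] R) (f : H →ₗ[ℂ] R) :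
    conv comulOp (conv comulOp f (j.toLinearMap ∘ₗ antipodeInv hS)) j.toLinearMap = f := by
  have h := conv_assoc (R := R) f (j.toLinearMap ∘ₗ antipodeInv hS) j.toLinearMap
    (comulOp_coassoc (H := H))
  rw [h, conv_antipodeInv, conv_counit_right]

/-- The left side is the sum of `a(h₂) j(S(h₁)) j(h₃)`; commuting the first two factors puts the
indices in convolution order. -/
theorem mul_adLeft (j : H →ₐ[ℂ] R) (a : H →ₗ[ℂ] R) (haj : ∀ x y, Commute (a x) (j y)) (h : H) :
    LinearMap.mul' ℂ R (TensorProduct.map a j.toLinearMap (adLeft h)) =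
      conv Coalgebra.comul (j.toLinearMap ∘ₗ HopfAlgebra.antipode ℂ)
        (conv Coalgebra.comul a j.toLinearMap) h := by
  rw [conv_apply]
  simp only [adLeft, comul₃, LinearMap.comp_apply]
  generalize Coalgebra.comul (R := ℂ) h = t
  induction t with
  | zero => simp
  | add s t hs ht => simp only [map_add, hs, ht]
  | tmul x y =>
    simp only [LinearMap.lTensor_tmul, TensorProduct.map_tmul, LinearMap.mul'_apply, conv_apply]
    generalize Coalgebra.comul (R := ℂ) y = t
    induction t with
    | zero => simp
    | add s t hs ht => simp only [map_add, TensorProduct.tmul_add, mul_add, hs, ht]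
    | tmul u v =>
      simp only [LinearMap.rTensor_tmul, LinearEquiv.coe_coe, TensorProduct.leftComm_tmul,
        LinearMap.lTensor_tmul, LinearMap.mul'_apply, TensorProduct.map_tmul,
        AlgHom.toLinearMap_apply, LinearMap.comp_apply, map_mul, ← mul_assoc]
      rw [(haj u _).eq]

/-- Here `a(h₂)` moves past `j(h₃)`, which leaves the indices in decreasing order, as co-opposite
convolution requires. -/
theorem mul_adRight (hS : Function.Bijective (HopfAlgebra.antipode ℂ (A := H)))
    (j : H →ₐ[ℂ] R) (a : H →ₗ[ℂ] R) (haj : ∀ x y, Commute (a x) (j y)) (h : H) :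
    LinearMap.mul' ℂ R (TensorProduct.map a j.toLinearMap (adRight hS h)) =
      conv comulOp (conv comulOp j.toLinearMap a) (j.toLinearMap ∘ₗ antipodeInv hS) h := by
  rw [conv_apply]
  simp only [adRight, comul₃, LinearMap.comp_apply, comulOp]
  generalize Coalgebra.comul (R := ℂ) h = t
  induction t with
  | zero => simp
  | add s t hs ht => simp only [map_add, hs, ht]
  | tmul x y =>
    simp only [LinearMap.lTensor_tmul, TensorProduct.map_tmul, LinearMap.mul'_apply, conv_apply,
      LinearEquiv.coe_coe, TensorProduct.comm_tmul, LinearMap.comp_apply]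
    generalize Coalgebra.comul (R := ℂ) y = t
    induction t with
    | zero => simp
    | add s t hs ht => simp only [map_add, TensorProduct.tmul_add, add_mul, hs, ht]
    | tmul u v =>
      simp only [LinearMap.rTensor_tmul, LinearEquiv.coe_coe, TensorProduct.leftComm_tmul,
        LinearMap.lTensor_tmul, LinearMap.mul'_apply, TensorProduct.map_tmul,
        AlgHom.toLinearMap_apply, LinearMap.comp_apply, map_mul, TensorProduct.comm_tmul]
      rw [← mul_assoc, (haj u _).eq]

end HopfConvolution

universe u v w x

/-! ### Grading involution and degree-zero projection of a calculus -/

namespace DifferentialCalculus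

variable {A : Type u} [Ring A] [Algebra ℂ A] (Γ : DifferentialCalculus.{u, v} A)

theorem parity_parity (a : Γ.carrier) : Γ.parity (Γ.parity a) = a := by
  induction a using Γ.induction_homogeneous with
  | add a b ha hb => rw [map_add, map_add, ha, hb]
  | hom n a ha =>
    rw [Γ.parity_of_mem ha, map_smul, Γ.parity_of_mem ha, smul_smul, ← mul_pow]
    simp

theorem parity_d (a : Γ.carrier) : Γ.parity (Γ.d a) = -Γ.d (Γ.parity a) := by
  induction a using Γ.induction_homogeneous with
  | add a b ha hb => simp only [map_add, ha, hb, neg_add]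
  | hom n a ha =>
    rw [Γ.parity_of_mem ha, Γ.parity_of_mem (Γ.d_mem _ _ ha), map_smul, pow_succ]
    simp

theorem d_mul (a b : Γ.carrier) : Γ.d (a * b) = Γ.d a * b + Γ.parity a * Γ.d b := by
  induction a using Γ.induction_homogeneous with
  | add a a' ha ha' =>
    simp only [map_add, add_mul, ha, ha']
    abel
  | hom n a ha => rw [Γ.leibniz n a b ha, Γ.parity_of_mem ha, smul_mul_assoc]

theorem projZero_of_mem {a : Γ.carrier} (ha : a ∈ Γ.grading 0) : Γ.projZero a = a :=
  DirectSum.decompose_of_mem_same _ ha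

theorem projZero_of_mem_ne {n : ℕ} (hn : n ≠ 0) {a : Γ.carrier} (ha : a ∈ Γ.grading n) :
    Γ.projZero a = 0 :=
  DirectSum.decompose_of_mem_ne _ ha hn

theorem projZero_mul (a b : Γ.carrier) : Γ.projZero (a * b) = Γ.projZero a * Γ.projZero b :=
  map_mul (GradedRing.projZeroRingHom Γ.grading) a b

/-- The projection onto the component of degree zero as a homomorphism of algebras. -/
def projZeroHom : Γ.carrier →ₐ[ℂ] Γ.carrier :=
  AlgHom.ofLinearMap Γ.projZero (Γ.projZero_of_mem (by simpa using Γ.incl_mem 1)) Γ.projZero_mul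

theorem degreeZero_incl (a : A) : Γ.degreeZero (Γ.incl a) = a := by
  apply Γ.incl_injective
  have h := LinearEquiv.apply_symm_apply
    (LinearEquiv.ofInjective Γ.incl.toLinearMap Γ.incl_injective)
    (LinearMap.codRestrict _ Γ.projZero Γ.projZero_mem_range (Γ.incl a))
  exact (congrArg Subtype.val h).trans (Γ.projZero_of_mem (Γ.incl_mem a))

theorem degreeZero_of_mem_ne {n : ℕ} (hn : n ≠ 0) {a : Γ.carrier} (ha : a ∈ Γ.grading n) :
    Γ.degreeZero a = 0 := by
  have h : LinearMap.codRestrict _ Γ.projZero Γ.projZero_mem_range a = 0 :=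
    Subtype.ext (Γ.projZero_of_mem_ne hn ha)
  rw [degreeZero, LinearMap.comp_apply, h, map_zero]

end DifferentialCalculus

/-- The degree-zero projection is multiplicative, so both sides are algebra homomorphisms and may be
compared on the generators `h` and `dh`; the projection kills `dh`, and also the first leg of its
coaction. -/
theorem coact_projZero {H : Type w} [Ring H] [HopfAlgebra ℂ H] {Γ : DifferentialCalculus.{w, v} H}
    (c : RightCovariant Γ) (a : Γ.carrier) :
    c.coact (Γ.projZero a) = Γ.projZero.rTensor H (c.coact a) := by
  have key : c.coact.comp Γ.projZeroHom =
      (Algebra.TensorProduct.map Γ.projZeroHom (AlgHom.id ℂ H)).comp c.coact := by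
    refine AlgHom.ext_of_adjoin_eq_top Γ.generated ?_
    rintro _ (⟨h, rfl⟩ | ⟨h, rfl⟩)
    · change c.coact (Γ.projZero (Γ.incl h)) = Γ.projZero.rTensor H (c.coact (Γ.incl h))
      rw [Γ.projZero_of_mem (Γ.incl_mem h), c.coact_incl,
        ← LinearMap.comp_apply (Γ.projZero.rTensor H), ← LinearMap.rTensor_comp]
      congr 2
      ext a
      simp [Γ.projZero_of_mem (Γ.incl_mem a)]
    · have hp (a : H) : Γ.projZero (Γ.d (Γ.incl a)) = 0 :=
        Γ.projZero_of_mem_ne one_ne_zero (Γ.d_mem _ _ (Γ.incl_mem a))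
      change c.coact (Γ.projZero (Γ.d (Γ.incl h))) =
        Γ.projZero.rTensor H (c.coact (Γ.d (Γ.incl h)))
      have h0 : Γ.projZero ∘ₗ Γ.d ∘ₗ Γ.incl.toLinearMap = 0 := LinearMap.ext hp
      rw [hp, map_zero, c.coact_d, ← LinearMap.comp_apply (Γ.projZero.rTensor H),
        ← LinearMap.rTensor_comp, h0, LinearMap.rTensor_zero, LinearMap.zero_apply]
  exact DFunLike.congr_fun key a

/-! ### The skew tensor product as a graded differential algebra with coaction -/

section Skew

variable {A : Type u} [Ring A] [Algebra ℂ A] {H : Type w} [Ring H] [HopfAlgebra ℂ H]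
  (Γ : DifferentialCalculus.{u, v} A) (Θ : DifferentialCalculus.{w, x} H)

/-- The grading involution of the skew tensor product. -/
def skewParity : Skew Γ Θ →ₗ[ℂ] Skew Γ Θ :=
  (toSkew Γ Θ).toLinearMap ∘ₗ TensorProduct.map Γ.parity Θ.parity ∘ₗ
    (toSkew Γ Θ).symm.toLinearMap

theorem skewParity_tmul (a : Γ.carrier) (b : Θ.carrier) :
    skewParity Γ Θ (toSkew Γ Θ (a ⊗ₜ b)) = toSkew Γ Θ (Γ.parity a ⊗ₜ Θ.parity b) := rfl

theorem skewD_tmul (a : Γ.carrier) (b : Θ.carrier) :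
    skewD Γ Θ (toSkew Γ Θ (a ⊗ₜ b)) =
      toSkew Γ Θ (Γ.d a ⊗ₜ b) + toSkew Γ Θ (Γ.parity a ⊗ₜ Θ.d b) := by
  rw [← map_add]
  rfl

theorem parity_parity_pow (n : ℕ) (a : Θ.carrier) :
    Θ.parity ((Θ.parity ^ n) a) = (Θ.parity ^ n) (Θ.parity a) := by
  rw [← Module.End.mul_apply, ← Module.End.mul_apply, ← pow_succ, ← pow_succ']

theorem d_parity_pow (n : ℕ) (a : Θ.carrier) :
    Θ.d ((Θ.parity ^ n) a) = (-1 : ℂ) ^ n • (Θ.parity ^ n) (Θ.d a) := by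
  induction n with
  | zero => simp
  | succ n ih =>
    rw [pow_succ', Module.End.mul_apply, Module.End.mul_apply,
      ← neg_neg (Θ.d (Θ.parity _)), ← Θ.parity_d, ih, map_smul, pow_succ']
    simp

theorem skewParity_mul (x y : Skew Γ Θ) :
    skewParity Γ Θ (x * y) = skewParity Γ Θ x * skewParity Γ Θ y := by
  induction x using skew_induction with
  | add x x' hx hx' => simp only [add_mul, map_add, hx, hx']
  | tmul a b =>
    induction y using skew_induction with
    | add y y' hy hy' => simp only [mul_add, map_add, hy, hy']
    | tmul a' b' =>
      induction a' using Γ.induction_homogeneous with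
      | add a' a'' h h' => simp only [TensorProduct.add_tmul, map_add, mul_add, h, h']
      | hom n a' ha' =>
        have ha : Γ.parity a' ∈ Γ.grading n := by
          rw [Γ.parity_of_mem ha']
          exact Submodule.smul_mem _ _ ha'
        rw [skew_mul Γ Θ a b ha' b', skewParity_tmul, skewParity_tmul, skewParity_tmul,
          skew_mul Γ Θ _ _ ha _, Γ.parity_mul, Θ.parity_mul, parity_parity_pow]

/-- On pure tensors with `a'` of degree `n`, the product carries `σⁿ(b)`. Differentiating that
factor costs `(-1)ⁿ`, which is cancelled by the sign of `σ(a')`; in the term with `da'` the exponent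
rises to `n + 1`, which is repaired by `σ² = 1`. -/
theorem skewD_mul (x y : Skew Γ Θ) :
    skewD Γ Θ (x * y) = skewD Γ Θ x * y + skewParity Γ Θ x * skewD Γ Θ y := by
  induction x using skew_induction with
  | add x x' hx hx' =>
    simp only [add_mul, map_add, hx, hx']
    abel
  | tmul a b =>
    induction y using skew_induction with
    | add y y' hy hy' =>
      simp only [mul_add, map_add, hy, hy']
      abel
    | tmul a' b' =>
      induction a' using Γ.induction_homogeneous with
      | add a' a'' h h' =>
        simp only [TensorProduct.add_tmul, map_add, mul_add, h, h']
        abel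
      | hom n a' ha' =>
        have ha : Γ.parity a' ∈ Γ.grading n := by
          rw [Γ.parity_of_mem ha']
          exact Submodule.smul_mem _ _ ha'
        rw [skew_mul Γ Θ a b ha' b', skewD_tmul, skewD_tmul, skewD_tmul, skewParity_tmul, add_mul,
          mul_add, skew_mul Γ Θ _ _ ha' _, skew_mul Γ Θ _ _ ha' _,
          skew_mul Γ Θ _ _ (Γ.d_mem _ _ ha') _, skew_mul Γ Θ _ _ ha _, Γ.d_mul, Γ.parity_mul,
          Θ.d_mul, pow_succ, Module.End.mul_apply, Θ.parity_parity, d_parity_pow,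
          parity_parity_pow, TensorProduct.add_tmul, TensorProduct.tmul_add, map_add, map_add,
          Γ.parity_of_mem ha', mul_smul_comm, smul_mul_assoc, TensorProduct.smul_tmul_smul,
          ← mul_pow, neg_one_mul, neg_neg, one_pow, one_smul]
        abel

theorem skewD_skewD (x : Skew Γ Θ) : skewD Γ Θ (skewD Γ Θ x) = 0 := by
  induction x using skew_induction with
  | add x x' hx hx' => simp only [map_add, hx, hx', add_zero]
  | tmul a b =>
    simp [skewD_tmul, Γ.d_d, Θ.d_d, Γ.parity_d, TensorProduct.neg_tmul]

theorem skewParity_skewParity (x : Skew Γ Θ) : skewParity Γ Θ (skewParity Γ Θ x) = x := by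
  induction x using skew_induction with
  | add x x' hx hx' => simp only [map_add, hx, hx']
  | tmul a b => simp only [skewParity_tmul, Γ.parity_parity, Θ.parity_parity]

theorem skewParity_skewD (x : Skew Γ Θ) :
    skewParity Γ Θ (skewD Γ Θ x) = -skewD Γ Θ (skewParity Γ Θ x) := by
  induction x using skew_induction with
  | add x x' hx hx' => simp only [map_add, hx, hx', neg_add]
  | tmul a b =>
    simp only [skewParity_tmul, skewD_tmul, map_add, Γ.parity_d, Θ.parity_d,
      TensorProduct.neg_tmul, TensorProduct.tmul_neg, map_neg, neg_add]

theorem skewDegree_induction {n : ℕ} {p : Skew Γ Θ → Prop} {x : Skew Γ Θ}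
    (hx : x ∈ skewDegree Γ Θ n)
    (tmul : ∀ (k l : ℕ) (a : Γ.carrier) (b : Θ.carrier), k + l = n → a ∈ Γ.grading k →
      b ∈ Θ.grading l → p (toSkew Γ Θ (a ⊗ₜ b)))
    (zero : p 0) (add : ∀ x y, p x → p y → p (x + y)) : p x := by
  refine Submodule.iSup_induction _ (motive := p) hx ?_ zero add
  rintro ⟨⟨k, l⟩, hkl⟩ _ ⟨_, ⟨t, rfl⟩, rfl⟩
  induction t with
  | zero => simpa using zero
  | add s t hs ht => simp only [map_add]; exact add _ _ hs ht
  | tmul a b => exact tmul k l a b hkl a.2 b.2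

theorem skewParity_of_mem {n : ℕ} {x : Skew Γ Θ} (hx : x ∈ skewDegree Γ Θ n) :
    skewParity Γ Θ x = (-1 : ℂ) ^ n • x := by
  refine skewDegree_induction Γ Θ (p := fun x => skewParity Γ Θ x = (-1 : ℂ) ^ n • x) hx
    (fun k l a b hkl ha hb => ?_) (by simp) fun x y hx hy => by rw [map_add, hx, hy, smul_add]
  rw [skewParity_tmul, Γ.parity_of_mem ha, Θ.parity_of_mem hb, TensorProduct.smul_tmul_smul,
    map_smul, ← pow_add, hkl]

theorem idCounit_tmul (a : Γ.carrier) (b : Θ.carrier) :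
    idCounit Γ Θ (toSkew Γ Θ (a ⊗ₜ b)) =
      Coalgebra.counit (R := ℂ) (A := H) (Θ.degreeZero b) • a := rfl

theorem idCounit_mem {n : ℕ} {x : Skew Γ Θ} (hx : x ∈ skewDegree Γ Θ n) :
    idCounit Γ Θ x ∈ Γ.grading n := by
  refine skewDegree_induction Γ Θ (p := fun x => idCounit Γ Θ x ∈ Γ.grading n) hx
    (fun k l a b hkl ha hb => ?_) (by simp) fun x y hx hy => by
      rw [map_add]; exact Submodule.add_mem _ hx hy
  rw [idCounit_tmul]
  -- The counit sees only `l = 0`, and then the first factor has the full degree `n`.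
  rcases eq_or_ne l 0 with rfl | hl
  · exact Submodule.smul_mem _ _ (by simpa [← hkl] using ha)
  · simp [Θ.degreeZero_of_mem_ne hl hb]

theorem skewIncl_mem_skewDegree (t : A ⊗[ℂ] H) : skewIncl Γ Θ t ∈ skewDegree Γ Θ 0 := by
  induction t with
  | zero => simp
  | add s t hs ht => rw [map_add]; exact Submodule.add_mem _ hs ht
  | tmul a h =>
    refine Submodule.mem_iSup_of_mem ⟨(0, 0), rfl⟩ ?_
    exact ⟨_, ⟨⟨Γ.incl a, Γ.incl_mem a⟩ ⊗ₜ ⟨Θ.incl h, Θ.incl_mem h⟩, rfl⟩, rfl⟩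

/-- The embedding `h ↦ 1 ⊗̂ h` of `H` into `Γ(A) ⊗̂ Γ(H)`. -/
def skewRight : H →ₐ[ℂ] Skew Γ Θ :=
  (GradedTensorProduct.includeRight Γ.grading Θ.grading).comp Θ.incl

theorem skewRight_apply (h : H) : skewRight Γ Θ h = toSkew Γ Θ (1 ⊗ₜ Θ.incl h) := rfl

theorem skewIncl_one_tmul (h : H) : skewIncl Γ Θ (1 ⊗ₜ h) = skewRight Γ Θ h := by
  simp [skewIncl, skewRight_apply]

theorem skewLeft_mul_skewRight (a : Γ.carrier) (h : H) :
    skewLeft Γ Θ a * skewRight Γ Θ h = toSkew Γ Θ (a ⊗ₜ Θ.incl h) := by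
  rw [skewLeft_apply, skewRight_apply, skew_mul_zero Γ Θ _ _ (by simpa using Θ.incl_mem 1),
    mul_one, one_mul]

theorem skewRight_mul_skewLeft (a : Γ.carrier) (h : H) :
    skewRight Γ Θ h * skewLeft Γ Θ a = toSkew Γ Θ (a ⊗ₜ Θ.incl h) := by
  rw [skewLeft_apply, skewRight_apply, skew_mul_zero Γ Θ _ _ (Θ.incl_mem h), mul_one, one_mul]

theorem commute_skewLeft_skewRight (a : Γ.carrier) (h : H) :
    Commute (skewLeft Γ Θ a) (skewRight Γ Θ h) :=
  (skewLeft_mul_skewRight Γ Θ a h).trans (skewRight_mul_skewLeft Γ Θ a h).symm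

theorem skewParity_skewLeft (a : Γ.carrier) :
    skewParity Γ Θ (skewLeft Γ Θ a) = skewLeft Γ Θ (Γ.parity a) := by
  have h := Θ.parity_incl 1
  rw [map_one] at h
  rw [skewLeft_apply, skewParity_tmul, h, skewLeft_apply]

theorem skewParity_skewRight (h : H) :
    skewParity Γ Θ (skewRight Γ Θ h) = skewRight Γ Θ h := by
  have h1 := Γ.parity_incl 1
  rw [map_one] at h1
  rw [skewRight_apply, skewParity_tmul, h1, Θ.parity_incl]

theorem skewD_one_tmul (b : Θ.carrier) :
    skewD Γ Θ (toSkew Γ Θ (1 ⊗ₜ b)) = toSkew Γ Θ (1 ⊗ₜ Θ.d b) := by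
  have h1 := Γ.parity_incl 1
  rw [map_one] at h1
  rw [skewD_tmul, Γ.d_one, h1, TensorProduct.zero_tmul, map_zero, zero_add]

theorem skewHor_induction {p : Skew Γ Θ → Prop} {x : Skew Γ Θ} (hx : x ∈ skewHor Γ Θ)
    (mul : ∀ (a : Γ.carrier) (h : H), p (skewLeft Γ Θ a * skewRight Γ Θ h))
    (add : ∀ x y, p x → p y → p (x + y)) : p x := by
  obtain ⟨_, ⟨t, rfl⟩, rfl⟩ := hx
  induction t with
  | zero => simpa using mul 0 0
  | add s t hs ht => simp only [map_add]; exact add _ _ hs ht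
  | tmul a h =>
    have := mul a h
    rwa [skewLeft_mul_skewRight] at this

theorem horCanonical_mem_skewHor (x : Skew Γ Θ) : horCanonical Γ Θ x ∈ skewHor Γ Θ := by
  induction x using skew_induction with
  | add x y hx hy => rw [map_add]; exact Submodule.add_mem _ hx hy
  | tmul a b =>
    obtain ⟨h, hh⟩ := Θ.projZero_mem_range b
    refine ⟨_, ⟨a ⊗ₜ h, rfl⟩, ?_⟩
    change toSkew Γ Θ (a ⊗ₜ Θ.incl h) = toSkew Γ Θ (a ⊗ₜ Θ.projZero b)
    rw [← hh]
    rfl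

variable {Θ} (c : RightCovariant Θ)

theorem skewCoact_tmul (a : Γ.carrier) (b : Θ.carrier) :
    skewCoact Γ c (toSkew Γ Θ (a ⊗ₜ b)) = (toSkew Γ Θ).toLinearMap.rTensor H
      ((TensorProduct.assoc ℂ Γ.carrier Θ.carrier H).symm (a ⊗ₜ c.coact b)) := rfl

/-- Equivariance of `hor_c`: the horizontal part of a pre-connection form inherits its
transformation law, and can then be recovered from its value under `id ⊗ ε`. -/
theorem skewCoact_horCanonical (x : Skew Γ Θ) :
    skewCoact Γ c (horCanonical Γ Θ x) = (horCanonical Γ Θ).rTensor H (skewCoact Γ c x) := by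
  induction x using skew_induction with
  | add x y hx hy => simp only [map_add, hx, hy]
  | tmul a b =>
    change skewCoact Γ c (toSkew Γ Θ (a ⊗ₜ Θ.projZero b)) = _
    rw [skewCoact_tmul, skewCoact_tmul, coact_projZero]
    generalize c.coact b = t
    induction t with
    | zero => simp
    | add s t hs ht => simp only [map_add, TensorProduct.tmul_add, hs, ht]
    | tmul b h => rfl

theorem skewCoact_mul_skewRight (a : Γ.carrier) (h : H) :
    skewCoact Γ c (skewLeft Γ Θ a * skewRight Γ Θ h) =
      (LinearMap.mulLeft ℂ (skewLeft Γ Θ a) ∘ₗ (skewRight Γ Θ).toLinearMap).rTensor H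
        (Coalgebra.comul (R := ℂ) h) := by
  rw [skewLeft_mul_skewRight, skewCoact_tmul, c.coact_incl]
  generalize Coalgebra.comul (R := ℂ) h = t
  induction t with
  | zero => simp
  | add s t hs ht => simp only [map_add, TensorProduct.tmul_add, hs, ht]
  | tmul h k =>
    simp only [LinearMap.rTensor_tmul, LinearMap.comp_apply, LinearMap.mulLeft_apply,
      AlgHom.toLinearMap_apply, skewLeft_mul_skewRight, TensorProduct.assoc_symm_tmul,
      LinearEquiv.coe_coe]

theorem skewCoact_skewRight (h : H) : skewCoact Γ c (skewRight Γ Θ h) =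
    (skewRight Γ Θ).toLinearMap.rTensor H (Coalgebra.comul (R := ℂ) h) := by
  have := skewCoact_mul_skewRight Γ c 1 h
  rwa [map_one, one_mul, LinearMap.mulLeft_one, LinearMap.id_comp] at this

/-- A horizontal form is determined by `(id ⊗ ε ⊗ id)` of its coaction. -/
theorem eq_of_mem_skewHor {x : Skew Γ Θ} (hx : x ∈ skewHor Γ Θ) :
    LinearMap.mul' ℂ _ (TensorProduct.map ((skewLeft Γ Θ).toLinearMap ∘ₗ idCounit Γ Θ)
      (skewRight Γ Θ).toLinearMap (skewCoact Γ c x)) = x := by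
  refine skewHor_induction Γ Θ (p := fun x => LinearMap.mul' ℂ _ (TensorProduct.map
    ((skewLeft Γ Θ).toLinearMap ∘ₗ idCounit Γ Θ) (skewRight Γ Θ).toLinearMap
      (skewCoact Γ c x)) = x) hx (fun a h => ?_) fun x y hx hy => by simp only [map_add, hx, hy]
  rw [skewCoact_mul_skewRight]
  have h1 (t : H ⊗[ℂ] H) : LinearMap.mul' ℂ _
      (TensorProduct.map ((skewLeft Γ Θ).toLinearMap ∘ₗ idCounit Γ Θ)
        (skewRight Γ Θ).toLinearMap
        ((LinearMap.mulLeft ℂ (skewLeft Γ Θ a) ∘ₗ (skewRight Γ Θ).toLinearMap).rTensor H t)) =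
      skewLeft Γ Θ a * skewRight Γ Θ (TensorProduct.lid ℂ H
        ((Coalgebra.counit (R := ℂ) (A := H)).rTensor H t)) := by
    induction t with
    | zero => simp
    | add s t hs ht => simp only [map_add, mul_add, hs, ht]
    -- The counit falls on the first leg of the comultiplication, so the counit axiom returns `h` in
    -- the second.
    | tmul h k =>
      simp only [LinearMap.rTensor_tmul, LinearMap.comp_apply, LinearMap.mulLeft_apply,
        AlgHom.toLinearMap_apply, TensorProduct.map_tmul, LinearMap.mul'_apply,
        skewLeft_mul_skewRight Γ Θ a h, idCounit_tmul, Θ.degreeZero_incl, map_smul,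
        TensorProduct.lid_tmul, smul_mul_assoc, mul_smul_comm]
  rw [h1, Coalgebra.rTensor_counit_comul, TensorProduct.lid_tmul, one_smul]

/-- A horizontal form with a known coaction is recovered by applying `id ⊗ ε`. -/
theorem eq_of_skewCoact_eq {x : Skew Γ Θ} (hx : x ∈ skewHor Γ Θ) {f : H →ₗ[ℂ] Skew Γ Θ}
    {t : H ⊗[ℂ] H} (h : skewCoact Γ c x = f.rTensor H t) :
    x = LinearMap.mul' ℂ _ (TensorProduct.map
      ((skewLeft Γ Θ).toLinearMap ∘ₗ idCounit Γ Θ ∘ₗ f) (skewRight Γ Θ).toLinearMap t) := by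
  refine (eq_of_mem_skewHor Γ c hx).symm.trans ?_
  rw [h]
  clear h
  induction t with
  | zero => simp
  | add s t hs ht => simp only [map_add, hs, ht]
  | tmul h k => simp

variable (Θ) in
theorem toSkew_maurerCartanLeft (h : H) :
    toSkew Γ Θ (1 ⊗ₜ maurerCartanLeft Θ h) =
      conv Coalgebra.comul ((skewRight Γ Θ).toLinearMap ∘ₗ HopfAlgebra.antipode ℂ)
        (skewD Γ Θ ∘ₗ (skewRight Γ Θ).toLinearMap) h := by
  rw [conv_apply]
  simp only [maurerCartanLeft, LinearMap.comp_apply]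
  generalize Coalgebra.comul (R := ℂ) h = t
  induction t with
  | zero => simp
  | add s t hs ht => simp only [map_add, TensorProduct.tmul_add, hs, ht]
  | tmul x y =>
    simp only [TensorProduct.map_tmul, LinearMap.mul'_apply, LinearMap.comp_apply,
      AlgHom.toLinearMap_apply, skewRight_apply, skewD_one_tmul]
    rw [skew_mul_zero Γ Θ _ _ (Θ.incl_mem _), one_mul]

variable (Θ) in
theorem toSkew_maurerCartanRight (hS : Function.Bijective (HopfAlgebra.antipode ℂ (A := H)))
    (h : H) :
    toSkew Γ Θ (1 ⊗ₜ maurerCartanRight Θ hS h) =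
      conv comulOp (skewD Γ Θ ∘ₗ (skewRight Γ Θ).toLinearMap)
        ((skewRight Γ Θ).toLinearMap ∘ₗ antipodeInv hS) h := by
  rw [conv_apply]
  simp only [maurerCartanRight, LinearMap.comp_apply, comulOp]
  generalize Coalgebra.comul (R := ℂ) h = t
  induction t with
  | zero => simp
  | add s t hs ht => simp only [map_add, TensorProduct.tmul_add, hs, ht]
  | tmul x y =>
    simp only [TensorProduct.map_tmul, LinearMap.mul'_apply, LinearMap.comp_apply,
      AlgHom.toLinearMap_apply, skewRight_apply, skewD_one_tmul, LinearEquiv.coe_coe,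
      TensorProduct.comm_tmul]
    exact (map_mul (GradedTensorProduct.includeRight Γ.grading Θ.grading) _ _)

end Skew

/-! ### Lifting local data to global forms -/

namespace DifferentialStructure

variable {I B H P : Type*} [Ring B] [Algebra ℂ B] [Ring H]
  [HopfAlgebra ℂ H] [Ring P] [Algebra ℂ P] {Q : LocallyTrivialQPFB I B H P}
  (G : DifferentialStructure Q)

/-- Homogeneous local forms on the base extend to homogeneous elements of `Γ_c(B)`. -/
theorem exists_gammaCB_of_mem_grading (i : I) {n : ℕ} {a : (G.calcB i).carrier}
    (ha : a ∈ (G.calcB i).grading n) :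
    ∃ γ : G.gammaCB, G.HasDegreeB n γ ∧ (γ : G.TotalB) i = a := by
  have hπ (b : B) : G.HasDegreeB 0 (G.πTotal b) := fun k => (G.calcB k).incl_mem _
  -- A monomial in the `b` and `db` is lifted factor by factor through `B → B/J_i`. The lift has the
  -- same degree in every component, not only in the `i`-th.
  have hmon (a : (G.calcB i).carrier) (ha : a ∈ Submonoid.closure
      (Set.range (G.calcB i).incl ∪ Set.range fun b => (G.calcB i).d ((G.calcB i).incl b))) :
      ∃ m, ∃ γ ∈ G.gammaB, G.HasDegreeB m γ ∧ γ i = a := by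
    induction ha using Submonoid.closure_induction with
    | mem a ha =>
      obtain ⟨b, rfl⟩ | ⟨b, rfl⟩ := ha <;> obtain ⟨b, rfl⟩ := Ideal.Quotient.mk_surjective b
      · exact ⟨0, G.πTotal b, Algebra.subset_adjoin (Or.inl ⟨b, rfl⟩), hπ b, rfl⟩
      · exact ⟨1, G.dTotalB (G.πTotal b), Algebra.subset_adjoin (Or.inr ⟨b, rfl⟩),
          fun k => (G.calcB k).d_mem _ _ (hπ b k), rfl⟩
    | one => exact ⟨0, 1, one_mem _, fun k => SetLike.one_mem_graded _, rfl⟩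
    | mul a b _ _ ha hb =>
      obtain ⟨m, γ, hγ, hm, rfl⟩ := ha
      obtain ⟨k, δ, hδ, hk, rfl⟩ := hb
      exact ⟨m + k, γ * δ, mul_mem hγ hδ, fun l => SetLike.mul_mem_graded (hm l) (hk l), rfl⟩
  -- Monomials span, but those summing to a form of degree `n` may have other degrees. Lifting the
  -- degree `n` projection discards them.
  have hspan (a : (G.calcB i).carrier) (n : ℕ) :
      ∃ γ ∈ G.gammaB, G.HasDegreeB n γ ∧ γ i = GradedRing.proj (G.calcB i).grading n a := by
    have ha : a ∈ Subalgebra.toSubmodule (Algebra.adjoin ℂ (Set.range (G.calcB i).incl ∪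
        Set.range fun b => (G.calcB i).d ((G.calcB i).incl b))) := by
      rw [(G.calcB i).generated]
      trivial
    rw [Algebra.adjoin_eq_span] at ha
    induction ha using Submodule.span_induction with
    | mem a ha =>
      obtain ⟨m, γ, hγ, hm, rfl⟩ := hmon a ha
      rcases eq_or_ne m n with rfl | hmn
      · exact ⟨γ, hγ, hm, (DirectSum.decompose_of_mem_same _ (hm i)).symm⟩
      · exact ⟨0, zero_mem _, fun k => Submodule.zero_mem _,
          (DirectSum.decompose_of_mem_ne _ (hm i) hmn).symm⟩
    | zero => exact ⟨0, zero_mem _, fun k => Submodule.zero_mem _, by simp⟩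
    | add a b _ _ ha hb =>
      obtain ⟨γ, hγ, hn, hi⟩ := ha
      obtain ⟨δ, hδ, hn', hi'⟩ := hb
      exact ⟨γ + δ, add_mem hγ hδ, fun k => Submodule.add_mem _ (hn k) (hn' k), by
        rw [Pi.add_apply, hi, hi', map_add]⟩
    | smul r a _ ha =>
      obtain ⟨γ, hγ, hn, hi⟩ := ha
      refine ⟨r • γ, Subalgebra.smul_mem _ hγ r, fun k => Submodule.smul_mem _ r (hn k), ?_⟩
      rw [Pi.smul_apply, hi]
      exact ((GradedAlgebra.proj (G.calcB i).grading n).map_smul r a).symm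
  obtain ⟨γ, hγ, hn, hi⟩ := hspan a n
  exact ⟨⟨γ, le_coveringCompletion _ hγ⟩, hn,
    hi.trans (DirectSum.decompose_of_mem_same _ ha)⟩

/-- Every `1 ⊗ h` is the `i`-th component of a horizontal element of degree zero. -/
theorem exists_hor_eq_skewRight (i : I) (h : H) :
    ∃ α : G.hor, G.HasDegree 0 α ∧
      (α : G.Total) i = skewRight (G.calcB i) G.calcH h := by
  -- The lift comes from `P` itself, hence has degree zero and is horizontal in every
  -- trivialization.
  obtain ⟨p, hp⟩ := Q.χ_surjective i (1 ⊗ₜ h)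
  refine ⟨⟨G.χTotal p, le_coveringCompletion _ (Algebra.subset_adjoin (Or.inl ⟨p, rfl⟩)),
    fun k => skewIncl_mem_skewHor _ _ _⟩, fun k => skewIncl_mem_skewDegree _ _ _, ?_⟩
  change skewIncl _ _ (Q.χ i p) = _
  rw [hp, skewIncl_one_tmul]

theorem proj_comp_leftCurvatureForm (ω : H →ₗ[ℂ] G.gammaCP) (i : I) :
    LinearMap.proj i ∘ₗ G.leftCurvatureForm ω =
      skewD (G.calcB i) G.calcH ∘ₗ LinearMap.proj i ∘ₗ G.toTotal ω -
        conv Coalgebra.comul (LinearMap.proj i ∘ₗ G.toTotal ω)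
          (LinearMap.proj i ∘ₗ G.toTotal ω) := by
  ext h
  simp only [leftCurvatureForm, LinearMap.comp_apply, LinearMap.sub_apply, map_sub, conv_apply]
  congr 1
  generalize Coalgebra.comul (R := ℂ) h = t
  induction t with
  | zero => simp
  | add s t hs ht => simp only [map_add, hs, ht]
  | tmul x y => rfl

theorem proj_comp_rightCurvatureForm (ω : H →ₗ[ℂ] G.gammaCP) (i : I) :
    LinearMap.proj i ∘ₗ G.rightCurvatureForm ω =
      skewD (G.calcB i) G.calcH ∘ₗ LinearMap.proj i ∘ₗ G.toTotal ω +
        conv comulOp (LinearMap.proj i ∘ₗ G.toTotal ω)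
          (LinearMap.proj i ∘ₗ G.toTotal ω) := by
  ext h
  simp only [rightCurvatureForm, LinearMap.comp_apply, LinearMap.add_apply, map_add, conv_apply,
    comulOp]
  congr 1
  generalize Coalgebra.comul (R := ℂ) h = t
  induction t with
  | zero => simp
  | add s t hs ht => simp only [map_add, hs, ht]
  | tmul x y => rfl

/-! ### Covariant derivatives and pre-connection forms in a trivialization -/

section Coaction

variable [Fintype I] [DecidableEq I]

theorem rTensor_proj_coactTotal (x : G.Total) (i : I) :
    (LinearMap.proj i : G.Total →ₗ[ℂ] G.Local i).rTensor H (G.coactTotal x) =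
      skewCoact (G.calcB i) G.covariant (x i) := by
  simp only [coactTotal, LinearMap.sum_apply, LinearMap.comp_apply, map_sum]
  rw [Finset.sum_eq_single i]
  · rw [← LinearMap.comp_apply, ← LinearMap.rTensor_comp, LinearMap.proj_comp_single_same,
      LinearMap.rTensor_id]
    rfl
  · intro k _ hk
    rw [← LinearMap.comp_apply, ← LinearMap.rTensor_comp,
      LinearMap.proj_comp_single_ne ℂ G.Local _ _ hk.symm, LinearMap.rTensor_zero]
    rfl
  · simp

theorem rTensor_proj_coactHor (α : G.hor) (i : I) :
    (LinearMap.proj i ∘ₗ G.horIncl).rTensor H (G.coactHor α) =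
      skewCoact (G.calcB i) G.covariant ((α : G.Total) i) := by
  rw [LinearMap.rTensor_comp, LinearMap.comp_apply, coactHor_eq, rTensor_proj_coactTotal]

variable {G} {D : G.hor →ₗ[ℂ] G.hor} {ω : H →ₗ[ℂ] G.gammaCP}

/-- A covariant derivative induces linear maps of the local calculi. -/
theorem IsCovariantDerivativeBase.exists_local (hD : G.IsCovariantDerivativeBase D) (i : I) :
    ∃ E : G.Local i →ₗ[ℂ] G.Local i, ∀ α : G.hor, (D α : G.Total) i = E ((α : G.Total) i) := by
  let p : G.hor →ₗ[ℂ] G.Local i := LinearMap.proj i ∘ₗ G.horIncl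
  -- `E` is `p ∘ D ∘ s` for a linear section `s` of `p`, extended arbitrarily outside the image of
  -- `p`. Locality of `D` makes the values on that image independent of `s`.
  obtain ⟨s, hs⟩ := p.rangeRestrict.exists_rightInverse_of_surjective p.range_rangeRestrict
  obtain ⟨E, hE⟩ := (p ∘ₗ D ∘ₗ s).exists_extend
  refine ⟨E, fun α => ?_⟩
  have h1 : p (s (p.rangeRestrict α)) = p α :=
    congrArg Subtype.val (LinearMap.congr_fun hs (p.rangeRestrict α))
  have h2 : E (p α) = p (D (s (p.rangeRestrict α))) :=
    LinearMap.congr_fun hE (p.rangeRestrict α)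
  have h3 := hD.localized i (α - s (p.rangeRestrict α)) (sub_eq_zero.2 h1.symm)
  rw [map_sub] at h3
  exact (sub_eq_zero.1 h3).trans h2.symm

/-- Degree one is read off from `D`: it raises by one the degree of a lift of `1 ⊗ h`, and `id ⊗ ε`
preserves degree. -/
theorem localForm_mem_grading (hD : G.IsCovariantDerivativeBase D) (hω : G.Corresponds ω D)
    (i : I) (h : H) : G.localForm ω i h ∈ (G.calcB i).grading 1 := by
  obtain ⟨α, hα, hi⟩ := G.exists_hor_eq_skewRight i h
  rw [hω i h α (by rw [hi, skewIncl_one_tmul])]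
  exact Submodule.neg_mem _ (idCounit_mem _ _ (hD.degree 0 α hα i))

/-- A local form of a covariant derivative, with values in the local calculus. -/
abbrev localFormTotal (G : DifferentialStructure Q) (ω : H →ₗ[ℂ] G.gammaCP) (i : I) :
    H →ₗ[ℂ] G.Local i :=
  (skewLeft (G.calcB i) G.calcH).toLinearMap ∘ₗ G.localForm ω i

theorem skewParity_comp_localFormTotal (hD : G.IsCovariantDerivativeBase D)
    (hω : G.Corresponds ω D) (i : I) :
    skewParity (G.calcB i) G.calcH ∘ₗ G.localFormTotal ω i = -G.localFormTotal ω i := by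
  ext h
  simp only [LinearMap.comp_apply, LinearMap.neg_apply, AlgHom.toLinearMap_apply]
  rw [skewParity_skewLeft, (G.calcB i).parity_of_mem (localForm_mem_grading hD hω i h),
    pow_one, neg_one_smul, map_neg]

/-- `E(1 ⊗̂ h)` is horizontal with coaction the sum of `E(1 ⊗̂ h₁) ⊗ h₂`, so it is determined by
`(id ⊗ ε) E(1 ⊗̂ h₁)`, which is `-A_i(h₁)`. -/
theorem local_skewRight (hD : G.IsCovariantDerivativeBase D) (hω : G.Corresponds ω D) {i : I}
    {E : G.Local i →ₗ[ℂ] G.Local i} (hE : ∀ α : G.hor, (D α : G.Total) i = E ((α : G.Total) i))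
    (h : H) :
    E (skewRight (G.calcB i) G.calcH h) = -conv Coalgebra.comul (G.localFormTotal ω i)
      (skewRight (G.calcB i) G.calcH).toLinearMap h := by
  obtain ⟨α, -, hi⟩ := G.exists_hor_eq_skewRight i h
  have hmem : E (skewRight (G.calcB i) G.calcH h) ∈ skewHor (G.calcB i) G.calcH := by
    rw [← hi, ← hE]
    exact (D α).2.2 i
  have hpD : (LinearMap.proj i ∘ₗ G.horIncl) ∘ₗ D = E ∘ₗ LinearMap.proj i ∘ₗ G.horIncl :=
    LinearMap.ext hE
  have hco : skewCoact (G.calcB i) G.covariant (E (skewRight (G.calcB i) G.calcH h)) =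
      (E ∘ₗ (skewRight (G.calcB i) G.calcH).toLinearMap).rTensor H
        (Coalgebra.comul (R := ℂ) h) := by
    rw [← hi, ← hE, ← rTensor_proj_coactHor, ← hD.covariant, ← LinearMap.comp_apply,
      ← LinearMap.rTensor_comp, hpD, LinearMap.rTensor_comp, LinearMap.comp_apply,
      rTensor_proj_coactHor, hi, skewCoact_skewRight, ← LinearMap.comp_apply,
      ← LinearMap.rTensor_comp]
  have hA : idCounit (G.calcB i) G.calcH ∘ₗ E ∘ₗ (skewRight (G.calcB i) G.calcH).toLinearMap =
      -G.localForm ω i := by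
    ext k
    obtain ⟨β, -, hβ⟩ := G.exists_hor_eq_skewRight i k
    have := hω i k β (by rw [hβ, skewIncl_one_tmul])
    rw [LinearMap.neg_apply, this, hE, hβ, neg_neg]
    rfl
  rw [eq_of_skewCoact_eq _ _ hmem hco, hA, LinearMap.comp_neg, ← LinearMap.neg_apply, ← neg_conv]
  rfl

/-- The global Leibniz rule is evaluated on a homogeneous lift of `a` to `Γ_c(B)` and a lift of `1 ⊗
h`; the involution absorbs its sign, so the formula holds for inhomogeneous `a` too. -/
theorem IsLeftCovariantDerivative.local_apply (hD : G.IsLeftCovariantDerivative D)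
    (hω : G.Corresponds ω D) {i : I} {E : G.Local i →ₗ[ℂ] G.Local i}
    (hE : ∀ α : G.hor, (D α : G.Total) i = E ((α : G.Total) i))
    (a : (G.calcB i).carrier) (h : H) :
    E (skewLeft (G.calcB i) G.calcH a * skewRight (G.calcB i) G.calcH h) =
      skewD (G.calcB i) G.calcH (skewLeft (G.calcB i) G.calcH a) *
        skewRight (G.calcB i) G.calcH h -
      skewParity (G.calcB i) G.calcH (skewLeft (G.calcB i) G.calcH a) *
        conv Coalgebra.comul (G.localFormTotal ω i)
          (skewRight (G.calcB i) G.calcH).toLinearMap h := by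
  induction a using (G.calcB i).induction_homogeneous with
  | add a b ha hb =>
    simp only [map_add, add_mul, ha, hb]
    abel
  | hom n a ha =>
    obtain ⟨γ, hγ, rfl⟩ := G.exists_gammaCB_of_mem_grading i ha
    obtain ⟨α, -, hi⟩ := G.exists_hor_eq_skewRight i h
    have h1 : (D (G.embedHor γ * α) : G.Total) i =
        E (skewLeft (G.calcB i) G.calcH ((γ : G.TotalB) i) * (α : G.Total) i) := hE _
    have h2 : (D (G.embedHor γ * α) : G.Total) i =
        skewD (G.calcB i) G.calcH (skewLeft (G.calcB i) G.calcH ((γ : G.TotalB) i)) *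
          (α : G.Total) i + (-1 : ℂ) ^ n • (skewLeft (G.calcB i) G.calcH ((γ : G.TotalB) i) *
            (D α : G.Total) i) := congrFun (hD.leibniz n γ α hγ) i
    rw [hE α, hi, local_skewRight hD.toIsCovariantDerivativeBase hω hE] at h2
    rw [← hi, ← h1, h2, skewParity_skewLeft, (G.calcB i).parity_of_mem (hγ i), map_smul, hi,
      mul_neg, smul_neg, smul_mul_assoc, sub_eq_add_neg]

theorem IsRightCovariantDerivative.local_apply (hD : G.IsRightCovariantDerivative D)
    (hω : G.Corresponds ω D) {i : I} {E : G.Local i →ₗ[ℂ] G.Local i}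
    (hE : ∀ α : G.hor, (D α : G.Total) i = E ((α : G.Total) i))
    (a : (G.calcB i).carrier) (h : H) :
    E (skewRight (G.calcB i) G.calcH h * skewLeft (G.calcB i) G.calcH a) =
      skewRight (G.calcB i) G.calcH h *
        skewD (G.calcB i) G.calcH (skewLeft (G.calcB i) G.calcH a) -
      conv comulOp (skewRight (G.calcB i) G.calcH).toLinearMap (G.localFormTotal ω i) h *
        skewLeft (G.calcB i) G.calcH a := by
  induction a using (G.calcB i).induction_homogeneous with
  | add a b ha hb =>
    simp only [map_add, mul_add, ha, hb]
    abel
  | hom n a ha =>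
    obtain ⟨γ, hγ, rfl⟩ := G.exists_gammaCB_of_mem_grading i ha
    obtain ⟨α, hα, hi⟩ := G.exists_hor_eq_skewRight i h
    have h1 : (D (α * G.embedHor γ) : G.Total) i =
        E ((α : G.Total) i * skewLeft (G.calcB i) G.calcH ((γ : G.TotalB) i)) := hE _
    -- The right Leibniz sign depends on the degree of the factor on the left; the lift `α` has
    -- degree zero, so there is no sign, whatever the degree of `γ`.
    have h2 : (D (α * G.embedHor γ) : G.Total) i =
        (D α : G.Total) i * skewLeft (G.calcB i) G.calcH ((γ : G.TotalB) i) +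
          (-1 : ℂ) ^ 0 • ((α : G.Total) i *
            skewD (G.calcB i) G.calcH (skewLeft (G.calcB i) G.calcH ((γ : G.TotalB) i))) :=
      congrFun (hD.leibniz 0 γ α hα) i
    have hc : conv comulOp (skewRight (G.calcB i) G.calcH).toLinearMap (G.localFormTotal ω i) h =
        conv Coalgebra.comul (G.localFormTotal ω i)
          (skewRight (G.calcB i) G.calcH).toLinearMap h :=
      conv_comm_comul _ _ _ h fun x y => (commute_skewLeft_skewRight _ _ _ _).symm
    rw [hE α, hi, local_skewRight hD.toIsCovariantDerivativeBase hω hE] at h2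
    rw [← hi, ← h1, h2, hc, hi, pow_zero, one_smul, neg_mul, neg_add_eq_sub]

/-- The horizontal part of a pre-connection form whose coaction is `(ω ⊗ id) ∘ r`. -/
theorem horCanonical_apply {r : H →ₗ[ℂ] H ⊗[ℂ] H} {h : H}
    (hr : G.coactTotal (ω h) = (G.toTotal ω).rTensor H (r h)) (i : I) :
    horCanonical (G.calcB i) G.calcH ((ω h : G.Total) i) =
      -LinearMap.mul' ℂ _ (TensorProduct.map (G.localFormTotal ω i)
        (skewRight (G.calcB i) G.calcH).toLinearMap (r h)) := by
  have hco : skewCoact (G.calcB i) G.covariant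
      (horCanonical (G.calcB i) G.calcH ((ω h : G.Total) i)) =
        (horCanonical (G.calcB i) G.calcH ∘ₗ LinearMap.proj i ∘ₗ G.toTotal ω).rTensor H (r h) := by
    rw [skewCoact_horCanonical, ← rTensor_proj_coactTotal, hr]
    simp only [LinearMap.rTensor_comp, LinearMap.comp_apply]
  have ha : (skewLeft (G.calcB i) G.calcH).toLinearMap ∘ₗ idCounit (G.calcB i) G.calcH ∘ₗ
      horCanonical (G.calcB i) G.calcH ∘ₗ LinearMap.proj i ∘ₗ G.toTotal ω =
        -G.localFormTotal ω i := by
    rw [localFormTotal, localForm, LinearMap.comp_neg, neg_neg]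
  rw [eq_of_skewCoact_eq _ _ (horCanonical_mem_skewHor _ _ _) hco, ha]
  exact LinearMap.congr_fun (neg_conv r (G.localFormTotal ω i) _) h

/-- All that the curvature computation needs to know about `ω`: covariance supplies the term with
`a`, the vertical condition the term with `dj`. -/
theorem IsLeftPreConnectionForm.conv_skewRight (hω : G.IsLeftPreConnectionForm ω) (i : I) :
    conv Coalgebra.comul (skewRight (G.calcB i) G.calcH).toLinearMap
        (LinearMap.proj i ∘ₗ G.toTotal ω) =
      -(conv Coalgebra.comul (G.localFormTotal ω i) (skewRight (G.calcB i) G.calcH).toLinearMap +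
        skewD (G.calcB i) G.calcH ∘ₗ (skewRight (G.calcB i) G.calcH).toLinearMap) := by
  have key : LinearMap.proj i ∘ₗ G.toTotal ω =
      conv Coalgebra.comul
        ((skewRight (G.calcB i) G.calcH).toLinearMap ∘ₗ HopfAlgebra.antipode ℂ)
        (-(conv Coalgebra.comul (G.localFormTotal ω i)
            (skewRight (G.calcB i) G.calcH).toLinearMap +
          skewD (G.calcB i) G.calcH ∘ₗ (skewRight (G.calcB i) G.calcH).toLinearMap)) := by
    ext h
    have h1 := horCanonical_apply (hω.covariant h) i
    have hc : ∀ x y, Commute (G.localFormTotal ω i x) (skewRight (G.calcB i) G.calcH y) :=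
      fun x y => commute_skewLeft_skewRight (G.calcB i) G.calcH (G.localForm ω i x) y
    rw [mul_adLeft (skewRight (G.calcB i) G.calcH) (G.localFormTotal ω i) hc] at h1
    have h2 := hω.vertical i h
    rw [toSkew_maurerCartanLeft, h1, sub_eq_iff_eq_add, ← neg_add_rev] at h2
    rw [conv_neg, conv_add]
    exact h2
  rw [key, conv_conv_antipode (skewRight (G.calcB i) G.calcH)]

theorem IsRightPreConnectionForm.conv_skewRight
    {hS : Function.Bijective (HopfAlgebra.antipode ℂ (A := H))}
    (hω : G.IsRightPreConnectionForm hS ω) (i : I) :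
    conv comulOp (LinearMap.proj i ∘ₗ G.toTotal ω)
        (skewRight (G.calcB i) G.calcH).toLinearMap =
      -(conv comulOp (skewRight (G.calcB i) G.calcH).toLinearMap (G.localFormTotal ω i) +
        skewD (G.calcB i) G.calcH ∘ₗ (skewRight (G.calcB i) G.calcH).toLinearMap) := by
  have key : LinearMap.proj i ∘ₗ G.toTotal ω =
      conv comulOp
        (-(conv comulOp (skewRight (G.calcB i) G.calcH).toLinearMap (G.localFormTotal ω i) +
          skewD (G.calcB i) G.calcH ∘ₗ (skewRight (G.calcB i) G.calcH).toLinearMap))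
        ((skewRight (G.calcB i) G.calcH).toLinearMap ∘ₗ antipodeInv hS) := by
    ext h
    have h1 := horCanonical_apply (hω.covariant h) i
    have hc : ∀ x y, Commute (G.localFormTotal ω i x) (skewRight (G.calcB i) G.calcH y) :=
      fun x y => commute_skewLeft_skewRight (G.calcB i) G.calcH (G.localForm ω i x) y
    rw [mul_adRight hS (skewRight (G.calcB i) G.calcH) (G.localFormTotal ω i) hc] at h1
    have h2 := hω.vertical i h
    rw [toSkew_maurerCartanRight, h1, sub_eq_iff_eq_add, ← neg_add_rev] at h2
    rw [neg_conv, add_conv]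
    exact h2
  rw [key, conv_conv_antipodeInv hS (skewRight (G.calcB i) G.calcH)]

/-! ### Comparison of the squared derivative with the curvature form -/

theorem mulRight_coactHor_apply (Ω : H →ₗ[ℂ] G.Total) (γ : G.hor) (i : I) :
    G.mulRight Ω (G.coactHor γ) i = LinearMap.mul' ℂ _ (TensorProduct.map LinearMap.id
      (LinearMap.proj i ∘ₗ Ω) (skewCoact (G.calcB i) G.covariant ((γ : G.Total) i))) := by
  rw [← rTensor_proj_coactHor]
  generalize G.coactHor γ = t
  induction t with
  | zero => simp
  | add s t hs ht => simp only [map_add, Pi.add_apply, hs, ht]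
  | tmul α h => rfl

theorem mulLeft_coactHor_apply (Ω : H →ₗ[ℂ] G.Total) (γ : G.hor) (i : I) :
    G.mulLeft Ω (G.coactHor γ) i = LinearMap.mul' ℂ _ (TensorProduct.map
      (LinearMap.proj i ∘ₗ Ω) LinearMap.id (TensorProduct.comm ℂ _ _
        (skewCoact (G.calcB i) G.covariant ((γ : G.Total) i)))) := by
  rw [← rTensor_proj_coactHor]
  generalize G.coactHor γ = t
  induction t with
  | zero => simp
  | add s t hs ht => simp only [map_add, Pi.add_apply, hs, ht]
  | tmul α h => rfl

/-- The square of a left covariant derivative is given by its curvature form. -/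
theorem IsLeftCovariantDerivative.sq_eq (hD : G.IsLeftCovariantDerivative D)
    (hω : G.IsLeftPreConnectionForm ω) (hωD : G.Corresponds ω D) (γ : G.hor) :
    (D (D γ) : G.Total) = G.mulRight (G.leftCurvatureForm ω) (G.coactHor γ) := by
  funext i
  obtain ⟨E, hE⟩ := hD.exists_local i
  rw [hE, hE, mulRight_coactHor_apply, proj_comp_leftCurvatureForm]
  have hdd : skewD (G.calcB i) G.calcH ∘ₗ skewD (G.calcB i) G.calcH = 0 :=
    LinearMap.ext (skewD_skewD _ _)
  have ha := skewParity_comp_localFormTotal hD.toIsCovariantDerivativeBase hωD i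
  have hcurv := conv_left_curvature (δ := Coalgebra.comul) Coalgebra.coassoc_apply
    (skewD_mul (G.calcB i) G.calcH) hdd
    (LinearMap.ext (skewParity_skewRight (G.calcB i) G.calcH)) ha (hω.conv_skewRight i)
  refine skewHor_induction (G.calcB i) G.calcH (p := fun x => E (E x) = LinearMap.mul' ℂ _
    (TensorProduct.map LinearMap.id _ (skewCoact (G.calcB i) G.covariant x))) (γ.2.2 i)
    (fun a h => ?_) fun x y hx hy => by simp only [map_add, hx, hy]
  -- `S` is `Γ(B_i) ⊗̂ 1`, which is closed under products, `d` and `σ` and contains the values of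
  -- the local form.
  have hsq := left_square (δ := Coalgebra.comul) (S := LinearMap.range
      (skewLeft (G.calcB i) G.calcH).toLinearMap) (E := E) (a := G.localFormTotal ω i)
    (j := (skewRight (G.calcB i) G.calcH).toLinearMap)
    (skewD_mul (G.calcB i) G.calcH) hdd
    (skewParity_mul _ _) (skewParity_skewParity _ _) (skewParity_skewD _ _)
    (by rintro _ ⟨x, rfl⟩ _ ⟨y, rfl⟩; exact ⟨x * y, (skewLeft (G.calcB i) G.calcH).map_mul x y⟩)
    (by rintro _ ⟨x, rfl⟩; exact ⟨_, (skewD_skewLeft _ _ x).symm⟩)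
    (by rintro _ ⟨x, rfl⟩; exact ⟨_, (skewParity_skewLeft _ _ x).symm⟩)
    (fun h => ⟨_, rfl⟩) ha
    (by rintro _ ⟨x, rfl⟩ k; exact hD.local_apply hωD hE x k) ⟨a, rfl⟩ h
  refine hsq.trans ?_
  rw [← hcurv, skewCoact_mul_skewRight, ← conv_mulLeft, conv_apply, ← LinearMap.comp_apply
    (TensorProduct.map LinearMap.id _), LinearMap.rTensor, ← TensorProduct.map_comp]
  rfl

/-- The square of a right covariant derivative is given by its curvature form. -/
theorem IsRightCovariantDerivative.sq_eq
    {hS : Function.Bijective (HopfAlgebra.antipode ℂ (A := H))}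
    (hD : G.IsRightCovariantDerivative D)
    (hω : G.IsRightPreConnectionForm hS ω) (hωD : G.Corresponds ω D) (γ : G.hor) :
    (D (D γ) : G.Total) = G.mulLeft (G.rightCurvatureForm ω) (G.coactHor γ) := by
  funext i
  obtain ⟨E, hE⟩ := hD.exists_local i
  rw [hE, hE, mulLeft_coactHor_apply, proj_comp_rightCurvatureForm]
  have hdd : skewD (G.calcB i) G.calcH ∘ₗ skewD (G.calcB i) G.calcH = 0 :=
    LinearMap.ext (skewD_skewD _ _)
  have ha := skewParity_comp_localFormTotal hD.toIsCovariantDerivativeBase hωD i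
  -- Oddness of the whole form `ω`, vertical part included; it follows from `ω` taking values in
  -- degree one.
  have hΩ : skewParity (G.calcB i) G.calcH ∘ₗ LinearMap.proj i ∘ₗ G.toTotal ω =
      -(LinearMap.proj i ∘ₗ G.toTotal ω) := by
    ext h
    refine (skewParity_of_mem _ _ (hω.degree h i)).trans ?_
    rw [pow_one, neg_one_smul]
    rfl
  have hcurv := conv_right_curvature (comulOp_coassoc (H := H))
    (skewD_mul (G.calcB i) G.calcH) hdd
    (LinearMap.ext (skewParity_skewRight (G.calcB i) G.calcH)) hΩ (hω.conv_skewRight i)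
  refine skewHor_induction (G.calcB i) G.calcH (p := fun x => E (E x) = LinearMap.mul' ℂ _
    (TensorProduct.map _ LinearMap.id (TensorProduct.comm ℂ _ _
      (skewCoact (G.calcB i) G.covariant x)))) (γ.2.2 i)
    (fun a h => ?_) fun x y hx hy => by simp only [map_add, hx, hy]
  have hsq := right_square (δ := comulOp) (S := LinearMap.range
      (skewLeft (G.calcB i) G.calcH).toLinearMap) (E := E) (a := G.localFormTotal ω i)
    (j := (skewRight (G.calcB i) G.calcH).toLinearMap)
    (skewD_mul (G.calcB i) G.calcH) hdd
    (by rintro _ ⟨x, rfl⟩ _ ⟨y, rfl⟩; exact ⟨x * y, (skewLeft (G.calcB i) G.calcH).map_mul x y⟩)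
    (by rintro _ ⟨x, rfl⟩; exact ⟨_, (skewD_skewLeft _ _ x).symm⟩)
    (fun h => ⟨_, rfl⟩) ha
    (by rintro _ ⟨x, rfl⟩ k; exact hD.local_apply hωD hE x k) ⟨a, rfl⟩ h
  -- Horizontal forms are spanned by `x j(h)`, whereas the right formula is stated for `j(h) x`; the
  -- two agree, also inside the coaction.
  have hcomm : LinearMap.mulLeft ℂ (skewLeft (G.calcB i) G.calcH a) ∘ₗ
      (skewRight (G.calcB i) G.calcH).toLinearMap =
        LinearMap.mulRight ℂ (skewLeft (G.calcB i) G.calcH a) ∘ₗ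
          (skewRight (G.calcB i) G.calcH).toLinearMap :=
    LinearMap.ext fun k => (commute_skewLeft_skewRight _ _ a k).eq
  rw [skewCoact_mul_skewRight, (commute_skewLeft_skewRight _ _ a h).eq]
  refine hsq.trans ?_
  rw [← hcurv, ← conv_mulRight, conv_apply, hcomm, comulOp, LinearMap.comp_apply]
  generalize Coalgebra.comul (R := ℂ) h = t
  induction t with
  | zero => simp
  | add s t hs ht => simp only [map_add, hs, ht]
  | tmul x y => rfl

end Coaction

end DifferentialStructure

end QPFB

end

theorem proposition16 {I B H P : Type*} [Fintype I] [DecidableEq I] [Ring B] [Algebra ℂ B]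
    [Ring H] [HopfAlgebra ℂ H] [Ring P] [Algebra ℂ P]
    (hS : Function.Bijective (HopfAlgebra.antipode ℂ (A := H)))
    (Q : QPFB.LocallyTrivialQPFB I B H P) (G : QPFB.DifferentialStructure Q) :
    (∀ (D : G.hor →ₗ[ℂ] G.hor) (ω : H →ₗ[ℂ] G.gammaCP),
      G.IsLeftCovariantDerivative D → G.IsLeftPreConnectionForm ω → G.Corresponds ω D →
      ∀ γ : G.hor, (D (D γ) : G.Total) = G.mulRight (G.leftCurvatureForm ω) (G.coactHor γ)) ∧
    (∀ (D : G.hor →ₗ[ℂ] G.hor) (ω : H →ₗ[ℂ] G.gammaCP),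
      G.IsRightCovariantDerivative D → G.IsRightPreConnectionForm hS ω → G.Corresponds ω D →
      ∀ γ : G.hor, (D (D γ) : G.Total) = G.mulLeft (G.rightCurvatureForm ω) (G.coactHor γ)) := by
  exact ⟨fun _ _ hD hω hωD => hD.sq_eq hω hωD, fun _ _ hD hω hωD => hD.sq_eq hω hωD⟩
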